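/- Let $n\ge 1$ be an integer and $\alpha>-1$ a real number. Let $\mathbb{D}$ be the open unit disk in $\mathbb{C}$ and let $$\mathrm{d}\mu_\alpha(z)=\frac{\alpha+1}{\pi}\,(1-|z|^2)^\alpha\,\mathrm{d}\mu(z)$$ on $\mathbb{D}$, where $\mu$ is the Lebesgue plane measure. A function $f\colon\mathbb{D}\to\mathbb{C}$ is called $n$-analytic if it is of class $C^n$ in the real sense and $(\partial/\partial\overline{z})^n f=0$ on $\mathbb{D}$. Let $\mathcal{A}_n^2(\mathbb{D},\mu_\alpha)$ be the space of $n$-analytic functions on $\mathbb{D}$ that are square integrable with respect to $\mu_\alpha$, with the inner product of $L^2(\mathbb{D},\mu_\alpha)$. For integers $p,q\ge 0$ and $z\in\mathbb{D}$ define the normalized disk polynomials $$b^{(\alpha)}_{p,q}(z)=(-1)^{p+q}\sqrt{\frac{(\alpha+p+q+1)\,\Gamma(\alpha+p+1)\,\Gamma(\alpha+q+1)}{(\alpha+1)\,p!\,q!\,\Gamma(\alpha+p+q+1)^2}}\;(1-z\overline{z})^{-\alpha}\,\frac{\partial^q}{\partial z^q}\frac{\partial^p}{\partial\overline{z}^p}\Bigl((1-z\overline{z})^{p+q+\alpha}\Bigr).$$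 Let $Q_m^{(\alpha,\beta)}(t)=P_m^{(\alpha,\beta)}(2t-1)$ be the shifted Jacobi polynomials, where $$P_m^{(\alpha,\beta)}(x)=\sum_{k=0}^m\binom{m+\alpha}{m-k}\binom{m+\beta}{k}\Bigl(\frac{x-1}{2}\Bigr)^k\Bigl(\frac{x+1}{2}\Bigr)^{m-k}.$$ Then: 1. Equivalently, for all $p,q\ge 0$ and $z\in\mathbb{D}$, $$b^{(\alpha)}_{p,q}(z)=\begin{cases}\sqrt{\dfrac{(\alpha+p+q+1)\,\Gamma(\alpha+p+1)\,q!}{(\alpha+1)\,\Gamma(\alpha+q+1)\,p!}}\;z^{p-q}\,Q_q^{(\alpha,p-q)}(|z|^2), & p\ge q,\\[2ex] \sqrt{\dfrac{(\alpha+p+q+1)\,\Gamma(\alpha+q+1)\,p!}{(\alpha+1)\,\Gamma(\alpha+p+1)\,q!}}\;\overline{z}^{\,q-p}\,Q_p^{(\alpha,q-p)}(|z|^2), & p<q.\end{cases}$$ 2. For all $p\ge 0$ and $0\le q<n$ the function $b^{(\alpha)}_{p,q}$ is $n$-analytic on $\mathbb{D}$, and the family $(b^{(\alpha)}_{p,q})_{p\ge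 0,\ 0\le q<n}$ is an orthonormal basis of the Hilbert space $\mathcal{A}_n^2(\mathbb{D},\mu_\alpha)$. -/

import Mathlib

open MeasureTheory

noncomputable section

namespace PolyBergman

/-- The open unit disk of the complex plane. -/
def disk : Set ℂ := Metric.ball 0 1

/-- The Wirtinger derivative `∂f/∂z = (∂f/∂x - i ∂f/∂y) / 2`. -/
def dz (f : ℂ → ℂ) (z : ℂ) : ℂ :=
  (fderiv ℝ f z 1 - Complex.I * fderiv ℝ f z Complex.I) / 2

/-- The Wirtinger derivative `∂f/∂z̄ = (∂f/∂x + i ∂f/∂y) / 2`. -/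
def dzbar (f : ℂ → ℂ) (z : ℂ) : ℂ :=
  (fderiv ℝ f z 1 + Complex.I * fderiv ℝ f z Complex.I) / 2

/-- `f` is `n`-analytic on the (open) set `U`: it is of class `C^n` in the real sense and
satisfies the generalized Cauchy-Riemann equation `(∂/∂z̄)^n f = 0` at every point of `U`. -/
def IsPolyanalyticOn (n : ℕ) (f : ℂ → ℂ) (U : Set ℂ) : Prop :=
  ContDiffOn ℝ n f U ∧ ∀ z ∈ U, dzbar^[n] f z = 0

/-- The weighted Lebesgue plane measure on the unit disk,
`dμ_α(z) = ((α + 1) / π) (1 - |z|²)^α dμ(z)`. -/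
def diskMeasure (α : ℝ) : Measure ℂ :=
  (volume.restrict disk).withDensity
    fun z => ENNReal.ofReal ((α + 1) / Real.pi * (1 - ‖z‖ ^ 2) ^ α)

/-! ### Closure properties of `n`-analytic functions -/

theorem isOpen_disk : IsOpen disk := Metric.isOpen_ball

theorem dzbar_congr {U : Set ℂ} (hU : IsOpen U) {f g : ℂ → ℂ} (h : Set.EqOn f g U) :
    Set.EqOn (dzbar f) (dzbar g) U := by
  intro z hz
  have : f =ᶠ[nhds z] g := Filter.eventuallyEq_of_mem (hU.mem_nhds hz) h
  simp only [dzbar, this.fderiv_eq]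

theorem dzbar_iterate_congr {U : Set ℂ} (hU : IsOpen U) (n : ℕ) {f g : ℂ → ℂ}
    (h : Set.EqOn f g U) : Set.EqOn (dzbar^[n] f) (dzbar^[n] g) U := by
  induction n generalizing f g with
  | zero => exact h
  | succ n ih =>
    simp only [Function.iterate_succ_apply]
    exact ih (dzbar_congr hU h)

theorem contDiffOn_dzbar {U : Set ℂ} (hU : IsOpen U) {n : ℕ} {f : ℂ → ℂ}
    (hf : ContDiffOn ℝ (n + 1 : ℕ) f U) : ContDiffOn ℝ n (dzbar f) U := by
  have h : ContDiffOn ℝ n (fderiv ℝ f) U :=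
    hf.fderiv_of_isOpen hU (by push_cast; exact le_rfl)
  exact ((h.clm_apply contDiffOn_const).add
    (contDiffOn_const.mul (h.clm_apply contDiffOn_const))).div_const 2

theorem dzbar_iterate_add {U : Set ℂ} (hU : IsOpen U) (n : ℕ) {f g : ℂ → ℂ}
    (hf : ContDiffOn ℝ n f U) (hg : ContDiffOn ℝ n g U) :
    Set.EqOn (dzbar^[n] (f + g)) (dzbar^[n] f + dzbar^[n] g) U := by
  induction n generalizing f g with
  | zero => exact fun _ _ => rfl
  | succ n ih =>
    have h1 : Set.EqOn (dzbar (f + g)) (dzbar f + dzbar g) U := by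
      intro z hz
      have hn : ((n + 1 : ℕ) : WithTop ℕ∞) ≠ 0 := by exact_mod_cast Nat.succ_ne_zero n
      have hfz := (hf.differentiableOn hn).differentiableAt (hU.mem_nhds hz)
      have hgz := (hg.differentiableOn hn).differentiableAt (hU.mem_nhds hz)
      simp only [dzbar, Pi.add_apply, fderiv_add hfz hgz, _root_.add_apply]
      ring
    intro z hz
    simp only [Function.iterate_succ_apply, Pi.add_apply]
    rw [dzbar_iterate_congr hU n h1 hz,
      ih (contDiffOn_dzbar hU hf) (contDiffOn_dzbar hU hg) hz]
    rfl

theorem dzbar_iterate_smul {U : Set ℂ} (hU : IsOpen U) (n : ℕ) (c : ℂ) {f : ℂ → ℂ}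
    (hf : ContDiffOn ℝ n f U) : Set.EqOn (dzbar^[n] (c • f)) (c • dzbar^[n] f) U := by
  induction n generalizing f with
  | zero => exact fun _ _ => rfl
  | succ n ih =>
    have h1 : Set.EqOn (dzbar (c • f)) (c • dzbar f) U := by
      intro z hz
      have hn : ((n + 1 : ℕ) : WithTop ℕ∞) ≠ 0 := by exact_mod_cast Nat.succ_ne_zero n
      have hfz := (hf.differentiableOn hn).differentiableAt (hU.mem_nhds hz)
      simp only [dzbar, Pi.smul_apply, fderiv_const_smul hfz c,
        _root_.smul_apply, smul_eq_mul]
      ring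
    intro z hz
    simp only [Function.iterate_succ_apply, Pi.smul_apply]
    rw [dzbar_iterate_congr hU n h1 hz, ih (contDiffOn_dzbar hU hf) hz]
    rfl

theorem dzbar_iterate_zero (n : ℕ) : dzbar^[n] 0 = 0 := by
  induction n with
  | zero => rfl
  | succ n ih =>
    have : dzbar 0 = 0 := by
      funext z
      simp [dzbar]
    rw [Function.iterate_succ_apply, this, ih]

/-- The weighted `n`-analytic Bergman space `A_n²(𝔻, μ_α)`: the (classes of) square integrable
functions with respect to `μ_α` that are `n`-analytic on the unit disk, with the inner product
of `L²(𝔻, μ_α)`. -/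
def polyBergman (n : ℕ) (α : ℝ) : Submodule ℂ (Lp ℂ 2 (diskMeasure α)) where
  carrier := {F | ∃ f : ℂ → ℂ, IsPolyanalyticOn n f disk ∧ F =ᵐ[diskMeasure α] f}
  zero_mem' :=
    ⟨0, ⟨contDiffOn_const, fun z _ => by rw [dzbar_iterate_zero]; rfl⟩, Lp.coeFn_zero _ _ _⟩
  add_mem' := by
    rintro F G ⟨f, hf, hF⟩ ⟨g, hg, hG⟩
    refine ⟨f + g, ⟨hf.1.add hg.1, fun z hz => ?_⟩, (Lp.coeFn_add F G).trans (hF.add hG)⟩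
    rw [dzbar_iterate_add isOpen_disk n hf.1 hg.1 hz, Pi.add_apply, hf.2 z hz, hg.2 z hz,
      add_zero]
  smul_mem' := by
    rintro c F ⟨f, hf, hF⟩
    refine ⟨c • f, ⟨contDiffOn_const.smul hf.1, fun z hz => ?_⟩,
      (Lp.coeFn_smul c F).trans (hF.const_smul c)⟩
    rw [dzbar_iterate_smul isOpen_disk n c hf.1 hz, Pi.smul_apply, hf.2 z hz, smul_zero]

/-! ### Disk polynomials -/

/-- The normalizing coefficient
`√((α+p+q+1) Γ(α+p+1) Γ(α+q+1) / ((α+1) p! q! Γ(α+p+q+1)²))`. -/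
def bcoef (α : ℝ) (p q : ℕ) : ℝ :=
  Real.sqrt ((α + p + q + 1) * Real.Gamma (α + p + 1) * Real.Gamma (α + q + 1) /
    ((α + 1) * p.factorial * q.factorial * Real.Gamma (α + p + q + 1) ^ 2))

/-- The normalized disk polynomial `b_{p,q}^{(α)}`, given on the unit disk by the Rodrigues-type
formula `(-1)^(p+q) c (1 - z z̄)^(-α) (∂/∂z)^q (∂/∂z̄)^p ((1 - z z̄)^(p+q+α))`, where `c` is
the normalizing coefficient. Values outside the open unit disk are irrelevant. -/
def diskPoly (α : ℝ) (p q : ℕ) (z : ℂ) : ℂ :=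
  (-1) ^ (p + q) * (bcoef α p q : ℂ) * (((1 - ‖z‖ ^ 2) ^ (-α) : ℝ) : ℂ) *
    dz^[q] (dzbar^[p] fun w : ℂ => (((1 - ‖w‖ ^ 2) ^ ((p : ℝ) + q + α) : ℝ) : ℂ)) z

/-- The Jacobi polynomial `P_m^{(α,β)}`, for arbitrary real parameters:
`∑_{k ≤ m} C(m+α, m-k) C(m+β, k) ((x-1)/2)^k ((x+1)/2)^(m-k)`, with generalized binomial
coefficients. -/
def jacobiP (m : ℕ) (α β x : ℝ) : ℝ :=
  ∑ k ∈ Finset.range (m + 1), Ring.choose ((m : ℝ) + α) (m - k) * Ring.choose ((m : ℝ) + β) k *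
    ((x - 1) / 2) ^ k * ((x + 1) / 2) ^ (m - k)

/-- The shifted Jacobi polynomial `Q_m^{(α,β)}(t) = P_m^{(α,β)}(2t - 1)`. -/
def jacobiQ (m : ℕ) (α β t : ℝ) : ℝ := jacobiP m α β (2 * t - 1)

/-- The expression of the normalized disk polynomials through shifted Jacobi polynomials. -/
def diskPolyJacobi (α : ℝ) (p q : ℕ) (z : ℂ) : ℂ :=
  if q ≤ p then
    (Real.sqrt ((α + p + q + 1) * Real.Gamma (α + p + 1) * q.factorial /
        ((α + 1) * Real.Gamma (α + q + 1) * p.factorial)) : ℂ) *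
      z ^ (p - q) * (jacobiQ q α ((p : ℝ) - q) (‖z‖ ^ 2) : ℂ)
  else
    (Real.sqrt ((α + p + q + 1) * Real.Gamma (α + q + 1) * p.factorial /
        ((α + 1) * Real.Gamma (α + p + 1) * q.factorial)) : ℂ) *
      (starRingEnd ℂ z) ^ (q - p) * (jacobiQ p α ((q : ℝ) - p) (‖z‖ ^ 2) : ℂ)

end PolyBergman

end

/-!
# Disk polynomials as an orthonormal basis of the weighted `n`-analytic Bergman space

Expanding the Rodrigues formula by the Leibniz rule shows that on the disk `b_{p,q} = κ S_{p,q}`,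
where `κ` is `rawNorm` and `S_{p,q}` is `rawPoly`, the explicit polynomial
`∑ k, (-1)^k C(q,k) (p! / (p-k)!) / Γ(α+k+1) z^(p-k) z̄^(q-k) (1 - z z̄)^k`
(`diskPoly_eq_rawPoly`). The formula with shifted Jacobi polynomials is the same sum
(`diskPolyJacobi_eq_rawPoly`).

An `n`-analytic function is the same thing as a polynomial of degree `< n` in `z̄` with holomorphic
coefficients (`isPolyanalyticOn_iff`), because `∂/∂z̄` can be integrated within such expressions.
As `S_{p,q}` has degree at most `q` in `z̄`, it is `n`-analytic for `q < n`.

*Orthonormality.* By rotation invariance `S_{p,q}` is orthogonal to `z^a z̄^b` unless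
`a - b = p - q`, and in that case Euler's beta integral turns the inner product into the `q`-th
forward difference of a polynomial of degree `b`, which vanishes for `b < q` and is explicit for
`b = q` (`integral_zmono_mul_rawPoly`). The norm of `S_{p,q}` follows from its leading coefficient,
which the Chu-Vandermonde identity evaluates (`integral_conj_rawPoly_mul_self`).

*Uniqueness.* If an `n`-analytic `f` is orthogonal to all `b_{p,q}` with `q < n`, it is orthogonal
to all monomials `z^p z̄^q` with `q < n`, by induction on `q`. Expanding the coefficients of `f` in
Taylor series and integrating over `|z| < r`, `r → 1`, only the terms `a_{k,j} z̄^k z^j` with a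
fixed `j - k` survive. For these finitely many coefficients the orthogonality relations form a
homogeneous linear system with a positive definite Hankel matrix, so `f = 0` (`eqOn_zero_of_integral_eq_zero`).

*Completeness of the space.* The constants `κ` grow at most polynomially in `p`, so an expansion
`∑ c_{p,q} b_{p,q}` with bounded coefficients converges pointwise on the disk to an `n`-analytic
function (`exists_hasSum_normPoly`). Hence the closed span of the `b_{p,q}` lies in the
`n`-analytic Bergman space; by uniqueness the two coincide, and the space is complete
(`completeSpace_polyBergman`).
-/

namespace PolyBergman

open ComplexConjugate

/-! ### Wirtinger calculus and the explicit form of the disk polynomials -/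

theorem dz_eq_of_hasFDerivAt {f : ℂ → ℂ} {L : ℂ →L[ℝ] ℂ} {z : ℂ} (h : HasFDerivAt f L z) :
    dz f z = (L 1 - Complex.I * L Complex.I) / 2 := by
  rw [dz, h.fderiv]

theorem dzbar_eq_of_hasFDerivAt {f : ℂ → ℂ} {L : ℂ →L[ℝ] ℂ} {z : ℂ} (h : HasFDerivAt f L z) :
    dzbar f z = (L 1 + Complex.I * L Complex.I) / 2 := by
  rw [dzbar, h.fderiv]

theorem dz_mul {f g : ℂ → ℂ} {z : ℂ} (hf : DifferentiableAt ℝ f z) (hg : DifferentiableAt ℝ g z) :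
    dz (fun w => f w * g w) z = dz f z * g z + f z * dz g z := by
  rw [dz_eq_of_hasFDerivAt (hf.hasFDerivAt.fun_mul hg.hasFDerivAt), dz, dz]
  simp
  ring

theorem dzbar_mul {f g : ℂ → ℂ} {z : ℂ} (hf : DifferentiableAt ℝ f z)
    (hg : DifferentiableAt ℝ g z) :
    dzbar (fun w => f w * g w) z = dzbar f z * g z + f z * dzbar g z := by
  rw [dzbar_eq_of_hasFDerivAt (hf.hasFDerivAt.fun_mul hg.hasFDerivAt), dzbar, dzbar]
  simp
  ring

theorem dz_of_hasDerivAt {f : ℂ → ℂ} {f' z : ℂ} (h : HasDerivAt f f' z) : dz f z = f' := by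
  rw [dz_eq_of_hasFDerivAt (h.hasFDerivAt.restrictScalars ℝ)]
  simp
  linear_combination (-f' / 2) * Complex.I_mul_I

theorem dzbar_of_differentiableAt {f : ℂ → ℂ} {z : ℂ} (h : DifferentiableAt ℂ f z) :
    dzbar f z = 0 := by
  rw [dzbar_eq_of_hasFDerivAt (h.hasDerivAt.hasFDerivAt.restrictScalars ℝ)]
  simp
  linear_combination (deriv f z) * Complex.I_mul_I

theorem hasFDerivAt_conj_comp {f : ℂ → ℂ} {f' z : ℂ} (h : HasDerivAt f f' z) :
    HasFDerivAt (fun w => conj (f w))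
      (Complex.conjCLE.toContinuousLinearMap.comp
        ((ContinuousLinearMap.toSpanSingleton ℂ f').restrictScalars ℝ)) z :=
  Complex.conjCLE.toContinuousLinearMap.hasFDerivAt.comp z (h.hasFDerivAt.restrictScalars ℝ)

theorem dz_conj_comp {f : ℂ → ℂ} {f' z : ℂ} (h : HasDerivAt f f' z) :
    dz (fun w => conj (f w)) z = 0 := by
  rw [dz_eq_of_hasFDerivAt (hasFDerivAt_conj_comp h)]
  simp
  linear_combination (conj f') * Complex.I_mul_I

theorem dzbar_conj_comp {f : ℂ → ℂ} {f' z : ℂ} (h : HasDerivAt f f' z) :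
    dzbar (fun w => conj (f w)) z = conj f' := by
  rw [dzbar_eq_of_hasFDerivAt (hasFDerivAt_conj_comp h)]
  simp
  linear_combination (-conj f' / 2) * Complex.I_mul_I

theorem one_sub_norm_sq_pos {z : ℂ} (hz : z ∈ disk) : 0 < 1 - ‖z‖ ^ 2 := by
  have h : ‖z‖ < 1 := by simpa [disk] using hz
  nlinarith [norm_nonneg z]

theorem one_sub_mul_conj_eq (z : ℂ) : 1 - z * conj z = ((1 - ‖z‖ ^ 2 : ℝ) : ℂ) := by
  rw [Complex.mul_conj']; push_cast; rfl

theorem hasFDerivAt_weight (s : ℝ) {z : ℂ} (hz : z ∈ disk) :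
    HasFDerivAt (fun w : ℂ => (((1 - ‖w‖ ^ 2) ^ s : ℝ) : ℂ))
      (Complex.ofRealCLM.comp
        ((s * (1 - ‖z‖ ^ 2) ^ (s - 1)) • (-((2 : ℝ) • innerSL ℝ z)))) z := by
  have h1 : HasFDerivAt (fun w : ℂ => 1 - ‖w‖ ^ 2) (-((2 : ℝ) • innerSL ℝ z)) z := by
    have := (hasStrictFDerivAt_norm_sq z).hasFDerivAt.const_sub (1 : ℝ)
    simpa [two_smul] using this
  have h2 := h1.rpow_const (p := s) (Or.inl (one_sub_norm_sq_pos hz).ne')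
  exact Complex.ofRealCLM.hasFDerivAt.comp z h2

theorem differentiableAt_weight (s : ℝ) {z : ℂ} (hz : z ∈ disk) :
    DifferentiableAt ℝ (fun w : ℂ => (((1 - ‖w‖ ^ 2) ^ s : ℝ) : ℂ)) z :=
  (hasFDerivAt_weight s hz).differentiableAt

theorem dz_weight (s : ℝ) {z : ℂ} (hz : z ∈ disk) :
    dz (fun w : ℂ => (((1 - ‖w‖ ^ 2) ^ s : ℝ) : ℂ)) z =
      -conj z * (s * ((1 - ‖z‖ ^ 2) ^ (s - 1) : ℝ)) := by
  rw [dz_eq_of_hasFDerivAt (hasFDerivAt_weight s hz)]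
  apply Complex.ext <;> simp [Complex.inner] <;> ring

theorem dzbar_weight (s : ℝ) {z : ℂ} (hz : z ∈ disk) :
    dzbar (fun w : ℂ => (((1 - ‖w‖ ^ 2) ^ s : ℝ) : ℂ)) z =
      -z * (s * ((1 - ‖z‖ ^ 2) ^ (s - 1) : ℝ)) := by
  rw [dzbar_eq_of_hasFDerivAt (hasFDerivAt_weight s hz)]
  apply Complex.ext <;> simp [Complex.inner] <;> ring

theorem dz_congr {U : Set ℂ} (hU : IsOpen U) {f g : ℂ → ℂ} (h : Set.EqOn f g U) :
    Set.EqOn (dz f) (dz g) U := by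
  intro z hz
  have : f =ᶠ[nhds z] g := Filter.eventuallyEq_of_mem (hU.mem_nhds hz) h
  simp only [dz, this.fderiv_eq]

theorem dz_iterate_congr {U : Set ℂ} (hU : IsOpen U) (n : ℕ) {f g : ℂ → ℂ}
    (h : Set.EqOn f g U) : Set.EqOn (dz^[n] f) (dz^[n] g) U := by
  induction n with
  | zero => exact h
  | succ n ih =>
    simp only [Function.iterate_succ_apply']
    exact dz_congr hU ih

theorem dz_sum {ι : Type*} (t : Finset ι) {f : ι → ℂ → ℂ} {z : ℂ}
    (hf : ∀ i ∈ t, DifferentiableAt ℝ (f i) z) :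
    dz (fun w => ∑ i ∈ t, f i w) z = ∑ i ∈ t, dz (f i) z := by
  rw [dz_eq_of_hasFDerivAt (HasFDerivAt.fun_sum fun i hi => (hf i hi).hasFDerivAt)]
  simp [dz, Finset.sum_sub_distrib, Finset.mul_sum, Finset.sum_div, sub_div]

theorem dzbar_sum {ι : Type*} (t : Finset ι) {f : ι → ℂ → ℂ} {z : ℂ}
    (hf : ∀ i ∈ t, DifferentiableAt ℝ (f i) z) :
    dzbar (fun w => ∑ i ∈ t, f i w) z = ∑ i ∈ t, dzbar (f i) z := by
  rw [dzbar_eq_of_hasFDerivAt (HasFDerivAt.fun_sum fun i hi => (hf i hi).hasFDerivAt)]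
  simp [dzbar, Finset.sum_add_distrib, Finset.mul_sum, Finset.sum_div, add_div]

/-- Leibniz rule for iterates of `∂/∂z`, with the iterated derivatives of both factors given as
sequences. -/
theorem dz_iterate_mul {U : Set ℂ} (hU : IsOpen U) {u v : ℕ → ℂ → ℂ}
    (hu : ∀ k, ∀ z ∈ U, DifferentiableAt ℝ (u k) z ∧ dz (u k) z = u (k + 1) z)
    (hv : ∀ k, ∀ z ∈ U, DifferentiableAt ℝ (v k) z ∧ dz (v k) z = v (k + 1) z) (m : ℕ) :
    Set.EqOn (dz^[m] fun w => u 0 w * v 0 w)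
      (fun w => ∑ k ∈ Finset.range (m + 1), (m.choose k : ℂ) * (u k w * v (m - k) w)) U := by
  induction m with
  | zero => intro z _; simp
  | succ m ih =>
    intro z hz
    rw [Function.iterate_succ_apply', dz_congr hU ih hz]
    have hd : ∀ k l, DifferentiableAt ℝ (fun w => u k w * v l w) z := fun k l =>
      (hu k z hz).1.mul (hv l z hz).1
    rw [dz_sum _ fun k _ => (hd _ _).const_mul _]
    beta_reduce
    rw [Finset.sum_choose_succ_mul (fun i j => u i z * v j z), ← Finset.sum_add_distrib]
    refine Finset.sum_congr rfl fun k hk => ?_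
    rw [dz_mul (differentiableAt_const _) (hd _ _), dz_mul (hu k z hz).1 (hv _ z hz).1,
      (hu k z hz).2, (hv _ z hz).2, dz_of_hasDerivAt (hasDerivAt_const z _),
      Nat.succ_sub (Nat.lt_succ_iff.1 (Finset.mem_range.1 hk))]
    ring

theorem dzbar_iterate_weight (s : ℝ) (m : ℕ) :
    Set.EqOn (dzbar^[m] fun w : ℂ => (((1 - ‖w‖ ^ 2) ^ s : ℝ) : ℂ))
      (fun w => (((descPochhammer ℝ m).eval s : ℝ) : ℂ) * (-w) ^ m *
        (((1 - ‖w‖ ^ 2) ^ (s - m) : ℝ) : ℂ)) disk := by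
  induction m with
  | zero => intro z _; simp
  | succ m ih =>
    intro z hz
    have hd : HasDerivAt (fun w : ℂ => (((descPochhammer ℝ m).eval s : ℝ) : ℂ) * (-w) ^ m)
        ((((descPochhammer ℝ m).eval s : ℝ) : ℂ) * (m * (-z) ^ (m - 1) * (-1))) z :=
      (((hasDerivAt_id z).neg.pow m).const_mul _)
    rw [Function.iterate_succ_apply', dzbar_congr isOpen_disk ih hz,
      dzbar_mul (hd.differentiableAt.restrictScalars ℝ) (differentiableAt_weight _ hz),
      dzbar_of_differentiableAt hd.differentiableAt, dzbar_weight _ hz, descPochhammer_succ_eval]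
    push_cast
    rw [sub_sub]
    ring

theorem dz_iterate_pow_mul_weight (s : ℝ) (c : ℂ) (p m : ℕ) :
    Set.EqOn (dz^[m] fun w : ℂ => c * w ^ p * (((1 - ‖w‖ ^ 2) ^ s : ℝ) : ℂ))
      (fun w => ∑ k ∈ Finset.range (m + 1), (m.choose k : ℂ) *
        ((c * p.descFactorial k * w ^ (p - k)) *
          ((((descPochhammer ℝ (m - k)).eval s : ℝ) : ℂ) * (-conj w) ^ (m - k) *
        (((1 - ‖w‖ ^ 2) ^ (s - (m - k : ℕ)) : ℝ) : ℂ)))) disk := by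
  have hu : ∀ k, ∀ z ∈ disk, DifferentiableAt ℝ
      (fun w : ℂ => c * p.descFactorial k * w ^ (p - k)) z ∧
      dz (fun w : ℂ => c * p.descFactorial k * w ^ (p - k)) z =
        c * p.descFactorial (k + 1) * z ^ (p - (k + 1)) := by
    intro k z _
    have hd : HasDerivAt (fun w : ℂ => c * p.descFactorial k * w ^ (p - k))
        (c * p.descFactorial k * (((p - k : ℕ) : ℂ) * z ^ (p - k - 1))) z :=
      (hasDerivAt_pow (p - k) z).const_mul _
    refine ⟨hd.differentiableAt.restrictScalars ℝ, ?_⟩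
    rw [dz_of_hasDerivAt hd, Nat.descFactorial_succ, Nat.sub_sub]
    push_cast
    ring
  have hv : ∀ j, ∀ z ∈ disk, DifferentiableAt ℝ
      (fun w : ℂ => (((descPochhammer ℝ j).eval s : ℝ) : ℂ) * (-conj w) ^ j *
        (((1 - ‖w‖ ^ 2) ^ (s - j) : ℝ) : ℂ)) z ∧
      dz (fun w : ℂ => (((descPochhammer ℝ j).eval s : ℝ) : ℂ) * (-conj w) ^ j *
        (((1 - ‖w‖ ^ 2) ^ (s - j) : ℝ) : ℂ)) z =
        (((descPochhammer ℝ (j + 1)).eval s : ℝ) : ℂ) * (-conj z) ^ (j + 1) *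
        (((1 - ‖z‖ ^ 2) ^ (s - (j + 1 : ℕ)) : ℝ) : ℂ) := by
    intro j z hz
    have hd : HasDerivAt (fun w : ℂ => (((descPochhammer ℝ j).eval s : ℝ) : ℂ) * (-w) ^ j)
        ((((descPochhammer ℝ j).eval s : ℝ) : ℂ) * (j * (-z) ^ (j - 1) * (-1))) z :=
      (((hasDerivAt_id z).neg.pow j).const_mul _)
    have he : (fun w : ℂ => (((descPochhammer ℝ j).eval s : ℝ) : ℂ) * (-conj w) ^ j) =
        fun w => conj ((((descPochhammer ℝ j).eval s : ℝ) : ℂ) * (-w) ^ j) := by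
      funext w; simp
    have hd1 : DifferentiableAt ℝ
        (fun w : ℂ => (((descPochhammer ℝ j).eval s : ℝ) : ℂ) * (-conj w) ^ j) z := by
      rw [he]; exact (hasFDerivAt_conj_comp hd).differentiableAt
    have hd2 : dz (fun w : ℂ => (((descPochhammer ℝ j).eval s : ℝ) : ℂ) * (-conj w) ^ j) z = 0 := by
      rw [he]; exact dz_conj_comp hd
    refine ⟨hd1.mul (differentiableAt_weight _ hz), ?_⟩
    rw [dz_mul hd1 (differentiableAt_weight _ hz), hd2, dz_weight _ hz, descPochhammer_succ_eval]
    push_cast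
    rw [sub_sub]
    ring
  have := dz_iterate_mul isOpen_disk hu hv m
  simpa using this

theorem descPochhammer_eval_eq_factorial_mul_choose (s : ℝ) (j : ℕ) :
    (descPochhammer ℝ j).eval s = j.factorial * Ring.choose s j := by
  rw [← nsmul_eq_mul, ← Ring.descPochhammer_eq_factorial_smul_choose, ← Polynomial.aeval_eq_smeval,
    ← descPochhammer_map (Int.castRingHom ℝ), Polynomial.eval_map, Polynomial.aeval_def]
  rfl

theorem descPochhammer_eval_mul_Gamma {s : ℝ} {j : ℕ} (h : 0 < s - j + 1) :
    (descPochhammer ℝ j).eval s * Real.Gamma (s - j + 1) = Real.Gamma (s + 1) := by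
  induction j with
  | zero => simp
  | succ j ih =>
    push_cast at h ⊢
    have h0 : 0 < s - j := by linarith
    rw [← ih (by linarith), descPochhammer_succ_eval, Real.Gamma_add_one h0.ne']
    ring_nf

/-- The disk polynomial without its normalizing constant, as an explicit polynomial in `z`, `z̄`.
In the terms with `p < k` the exponent `p - k` is truncated, but there the coefficient
`p.descFactorial k` vanishes. -/
noncomputable def rawPoly (α : ℝ) (p q : ℕ) (z : ℂ) : ℂ :=
  ∑ k ∈ Finset.range (q + 1), (-1) ^ k *
    ((q.choose k * p.descFactorial k / Real.Gamma (α + k + 1) : ℝ) : ℂ) *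
      (z ^ (p - k) * conj z ^ (q - k) * (1 - z * conj z) ^ k)

/-- The constant relating `rawPoly` to the normalized disk polynomial. -/
noncomputable def rawNorm (α : ℝ) (p q : ℕ) : ℝ :=
  Real.sqrt ((α + p + q + 1) * Real.Gamma (α + p + 1) * Real.Gamma (α + q + 1) /
    ((α + 1) * p.factorial * q.factorial))

theorem Gamma_shift_pos {α : ℝ} (hα : -1 < α) (k : ℕ) : 0 < Real.Gamma (α + k + 1) := by
  apply Real.Gamma_pos_of_pos
  have : (0 : ℝ) ≤ k := k.cast_nonneg
  linarith

theorem bcoef_eq {α : ℝ} (hα : -1 < α) (p q : ℕ) :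
    bcoef α p q = rawNorm α p q / Real.Gamma (α + p + q + 1) := by
  have h := Gamma_shift_pos hα (p + q)
  push_cast at h
  rw [← add_assoc] at h
  rw [bcoef, rawNorm, ← div_div, Real.sqrt_div' _ (by positivity), Real.sqrt_sq h.le]

/-- The Rodrigues formula evaluated by the Leibniz rule. -/
theorem diskPoly_eq_rawPoly {α : ℝ} (hα : -1 < α) (p q : ℕ) :
    Set.EqOn (diskPoly α p q) (fun z => (rawNorm α p q : ℂ) * rawPoly α p q z) disk := by
  intro z hz
  have hpos := one_sub_norm_sq_pos hz
  have h1 : Set.EqOn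
      (dzbar^[p] fun w : ℂ => (((1 - ‖w‖ ^ 2) ^ ((p : ℝ) + q + α) : ℝ) : ℂ))
      (fun w => ((-1) ^ p * (((descPochhammer ℝ p).eval ((p : ℝ) + q + α) : ℝ) : ℂ)) *
        w ^ p * (((1 - ‖w‖ ^ 2) ^ ((q : ℝ) + α) : ℝ) : ℂ)) disk := by
    intro w hw
    simp only [dzbar_iterate_weight _ _ hw, neg_pow w]
    rw [show (p : ℝ) + q + α - p = q + α by ring]
    ring
  have hΓ : Real.Gamma (q + α + 1) ≠ 0 := by
    have := (Gamma_shift_pos hα q).ne'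
    rwa [add_comm α] at this
  have hΓ' : Real.Gamma (α + p + q + 1) ≠ 0 := by
    have := (Gamma_shift_pos hα (p + q)).ne'
    push_cast at this
    rwa [← add_assoc] at this
  have hp : (descPochhammer ℝ p).eval ((p : ℝ) + q + α) =
      Real.Gamma (α + p + q + 1) / Real.Gamma (q + α + 1) := by
    have h : 0 < (p : ℝ) + q + α - p + 1 := by
      have : (0 : ℝ) ≤ q := q.cast_nonneg
      linarith
    rw [eq_div_iff hΓ]
    have := descPochhammer_eval_mul_Gamma h
    rwa [show (p : ℝ) + q + α - p + 1 = q + α + 1 by ring,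
      show (p : ℝ) + q + α + 1 = α + p + q + 1 by ring] at this
  simp only [diskPoly]
  rw [dz_iterate_congr isOpen_disk q h1 hz, dz_iterate_pow_mul_weight _ _ _ _ hz]
  simp only [rawPoly, Finset.mul_sum]
  refine Finset.sum_congr rfl fun k hk => ?_
  have hk' : k ≤ q := Nat.lt_succ_iff.1 (Finset.mem_range.1 hk)
  have hΓk := (Gamma_shift_pos hα k).ne'
  have hq : (descPochhammer ℝ (q - k)).eval ((q : ℝ) + α) =
      Real.Gamma (q + α + 1) / Real.Gamma (α + k + 1) := by
    have e : (q : ℝ) + α - (q - k : ℕ) + 1 = α + k + 1 := by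
      push_cast [Nat.cast_sub hk']; ring
    have h : 0 < (q : ℝ) + α - (q - k : ℕ) + 1 := by
      rw [e]
      have : (0 : ℝ) ≤ k := k.cast_nonneg
      linarith
    rw [eq_div_iff hΓk, ← e]
    exact descPochhammer_eval_mul_Gamma h
  have hw : (1 - ‖z‖ ^ 2) ^ ((q : ℝ) + α - (q - k : ℕ)) =
      (1 - ‖z‖ ^ 2) ^ α * (1 - ‖z‖ ^ 2) ^ k := by
    rw [← Real.rpow_natCast (1 - ‖z‖ ^ 2) k, ← Real.rpow_add hpos, Nat.cast_sub hk']
    congr 1; ring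
  have hne : (((1 - ‖z‖ ^ 2) ^ α : ℝ) : ℂ) ≠ 0 := by
    exact_mod_cast (Real.rpow_pos_of_pos hpos α).ne'
  have hsign : (-1 : ℂ) ^ (p + q) * (-1) ^ p * (-1) ^ (q - k) = (-1) ^ k := by
    obtain ⟨d, rfl⟩ := Nat.exists_eq_add_of_le hk'
    rw [Nat.add_sub_cancel_left, ← pow_add, ← pow_add,
      show p + (k + d) + p + d = k + 2 * (p + d) by ring, pow_add, pow_mul]
    simp
  have c1 : (Real.Gamma (q + α + 1) : ℂ) ≠ 0 := by exact_mod_cast hΓ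
  have c2 : (Real.Gamma (α + p + q + 1) : ℂ) ≠ 0 := by exact_mod_cast hΓ'
  have c3 : (Real.Gamma (α + k + 1) : ℂ) ≠ 0 := by exact_mod_cast hΓk
  rw [bcoef_eq hα, hp, hq, hw, one_sub_mul_conj_eq, Real.rpow_neg hpos.le,
    neg_pow (conj z), ← hsign]
  push_cast at hne ⊢
  field_simp

theorem choose_mul_factorial_div_Gamma {α : ℝ} (hα : -1 < α) {m k : ℕ} (hk : k ≤ m) :
    Ring.choose ((m : ℝ) + α) (m - k) * (m.factorial / Real.Gamma (α + m + 1)) =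
      m.descFactorial k / Real.Gamma (α + k + 1) := by
  have e : (m : ℝ) + α - (m - k : ℕ) + 1 = α + k + 1 := by
    push_cast [Nat.cast_sub hk]; ring
  have h : 0 < (m : ℝ) + α - (m - k : ℕ) + 1 := by
    rw [e]
    have : (0 : ℝ) ≤ k := k.cast_nonneg
    linarith
  have h1 := descPochhammer_eval_mul_Gamma h
  rw [e, descPochhammer_eval_eq_factorial_mul_choose, add_comm (m : ℝ) α] at h1
  have h2 : (((m - k).factorial : ℕ) : ℝ) * m.descFactorial k = m.factorial := by
    exact_mod_cast Nat.factorial_mul_descFactorial hk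
  have hΓk := (Gamma_shift_pos hα k).ne'
  have hΓm := (Gamma_shift_pos hα m).ne'
  have hf : (((m - k).factorial : ℕ) : ℝ) ≠ 0 := by positivity
  rw [← h2, add_comm (m : ℝ) α, mul_div_assoc', div_eq_div_iff hΓm hΓk, ← h1]
  ring

theorem sqrt_jacobi_eq {α : ℝ} (hα : -1 < α) (p q : ℕ) :
    Real.sqrt ((α + p + q + 1) * Real.Gamma (α + p + 1) * q.factorial /
        ((α + 1) * Real.Gamma (α + q + 1) * p.factorial)) =
      rawNorm α p q * (q.factorial / Real.Gamma (α + q + 1)) := by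
  have hq := Gamma_shift_pos hα q
  have h0 : α + 1 ≠ 0 := by linarith
  rw [rawNorm, ← Real.sqrt_sq (show 0 ≤ q.factorial / Real.Gamma (α + q + 1) by positivity),
    ← Real.sqrt_mul' _ (sq_nonneg _)]
  congr 1
  field_simp

theorem rawNorm_comm (α : ℝ) (p q : ℕ) : rawNorm α p q = rawNorm α q p := by
  rw [rawNorm, rawNorm]
  congr 1
  ring

/-- The expression of the disk polynomials through shifted Jacobi polynomials. -/
theorem diskPolyJacobi_eq_rawPoly {α : ℝ} (hα : -1 < α) (p q : ℕ) (z : ℂ) :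
    diskPolyJacobi α p q z = (rawNorm α p q : ℂ) * rawPoly α p q z := by
  have ht : ((‖z‖ ^ 2 : ℝ) : ℂ) = z * conj z := by
    rw [Complex.mul_conj']; push_cast; rfl
  have hsub : ∀ k : ℕ, (((((2 * ‖z‖ ^ 2 - 1 - 1) / 2) ^ k : ℝ)) : ℂ) =
      (-1) ^ k * (1 - z * conj z) ^ k := by
    intro k
    rw [← mul_pow, ← ht]
    push_cast
    congr 1
    ring
  have hadd : ∀ k : ℕ, (((((2 * ‖z‖ ^ 2 - 1 + 1) / 2) ^ k : ℝ)) : ℂ) =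
      z ^ k * conj z ^ k := by
    intro k
    rw [← mul_pow, ← ht]
    push_cast
    congr 1
    ring
  rw [diskPolyJacobi]
  split_ifs with h
  · rw [sqrt_jacobi_eq hα, rawPoly, jacobiQ, jacobiP, Complex.ofReal_sum, Finset.mul_sum,
      Finset.mul_sum]
    refine Finset.sum_congr rfl fun k hk => ?_
    have hk' : k ≤ q := Nat.lt_succ_iff.1 (Finset.mem_range.1 hk)
    have h1 := choose_mul_factorial_div_Gamma hα hk'
    have h2 : ((q.choose k * p.descFactorial k / Real.Gamma (α + k + 1) : ℝ)) =
        Ring.choose ((q : ℝ) + α) (q - k) * (q.factorial / Real.Gamma (α + q + 1)) *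
          p.choose k := by
      rw [h1, Nat.descFactorial_eq_factorial_mul_choose, Nat.descFactorial_eq_factorial_mul_choose]
      push_cast
      ring
    rw [h2, Complex.ofReal_mul _ (_ ^ _), Complex.ofReal_mul _ (_ ^ _), hsub, hadd,
      show (q : ℝ) + (p - q) = p by ring, Ring.choose_natCast,
      show p - k = (p - q) + (q - k) by omega, pow_add]
    push_cast
    ring
  · have hpq : p + 1 ≤ q + 1 := by omega
    rw [show α + p + q + 1 = α + q + p + 1 by ring, sqrt_jacobi_eq hα, rawNorm_comm, rawPoly,
      jacobiQ, jacobiP, Complex.ofReal_sum, Finset.mul_sum, Finset.mul_sum]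
    -- the terms with `p < k ≤ q` vanish
    have hsplit := Finset.sum_subset (Finset.range_mono hpq)
      (f := fun k => (rawNorm α p q : ℂ) * ((-1) ^ k *
        ((q.choose k * p.descFactorial k / Real.Gamma (α + k + 1) : ℝ) : ℂ) *
        (z ^ (p - k) * conj z ^ (q - k) * (1 - z * conj z) ^ k))) (by
        intro k _ hk
        have : p < k := by simpa using hk
        simp [Nat.descFactorial_eq_zero_iff_lt.2 this])
    rw [← hsplit]
    refine Finset.sum_congr rfl fun k hk => ?_
    have hk' : k ≤ p := Nat.lt_succ_iff.1 (Finset.mem_range.1 hk)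
    have h1 := choose_mul_factorial_div_Gamma hα hk'
    have h2 : ((q.choose k * p.descFactorial k / Real.Gamma (α + k + 1) : ℝ)) =
        Ring.choose ((p : ℝ) + α) (p - k) * (p.factorial / Real.Gamma (α + p + 1)) *
          q.choose k := by
      rw [h1]
      ring
    rw [h2, Complex.ofReal_mul _ (_ ^ _), Complex.ofReal_mul _ (_ ^ _), hsub, hadd,
      show (p : ℝ) + (q - p) = q by ring, Ring.choose_natCast,
      show q - k = (q - p) + (p - k) by omega, pow_add]
    push_cast
    ring

/-! ### Structure of `n`-analytic functions -/

/-- `f` is a polynomial of degree `< n` in `z̄` with coefficients holomorphic on `U`. This is an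
equivalent description of `n`-analytic functions, see `isPolyanalyticOn_iff`. -/
def HasHolomorphicCoeffs (n : ℕ) (f : ℂ → ℂ) (U : Set ℂ) : Prop :=
  ∃ g : ℕ → ℂ → ℂ, (∀ k, DifferentiableOn ℂ (g k) U) ∧
    ∀ z ∈ U, f z = ∑ k ∈ Finset.range n, conj z ^ k * g k z

theorem contDiff_conj {n : WithTop ℕ∞} : ContDiff ℝ n (fun z : ℂ => conj z) :=
  Complex.conjCLE.contDiff

/-- `∂/∂z̄` acts on `z̄^k g(z)`, with `g` holomorphic, as if `z` and `z̄` were independent. -/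
theorem dzbar_conj_pow_mul {g : ℂ → ℂ} {z : ℂ} (hg : DifferentiableAt ℂ g z) (k : ℕ) :
    dzbar (fun w => conj w ^ k * g w) z = k * conj z ^ (k - 1) * g z := by
  have hd : HasDerivAt (fun w : ℂ => w ^ k) (k * z ^ (k - 1)) z := hasDerivAt_pow k z
  have he : (fun w : ℂ => conj w ^ k) = fun w => conj (w ^ k) := by funext w; simp
  have h1 : DifferentiableAt ℝ (fun w : ℂ => conj w ^ k) z := by
    rw [he]; exact (hasFDerivAt_conj_comp hd).differentiableAt
  rw [dzbar_mul h1 (hg.restrictScalars ℝ), dzbar_of_differentiableAt hg, he, dzbar_conj_comp hd]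
  simp

theorem differentiableAt_conj_pow_mul {g : ℂ → ℂ} {z : ℂ} (hg : DifferentiableAt ℂ g z) (k : ℕ) :
    DifferentiableAt ℝ (fun w => conj w ^ k * g w) z :=
  (((contDiff_conj (n := 1)).differentiable one_ne_zero z).pow k).mul (hg.restrictScalars ℝ)

namespace HasHolomorphicCoeffs

variable {U : Set ℂ} {n : ℕ} {f g h : ℂ → ℂ}

theorem congr (hf : HasHolomorphicCoeffs n f U) (hfg : Set.EqOn g f U) :
    HasHolomorphicCoeffs n g U := by
  obtain ⟨c, hc, hf⟩ := hf
  exact ⟨c, hc, fun z hz => (hfg hz).trans (hf z hz)⟩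

theorem of_differentiableOn (hh : DifferentiableOn ℂ h U) : HasHolomorphicCoeffs 1 h U :=
  ⟨fun _ => h, fun _ => hh, fun z _ => by simp⟩

theorem add (hf : HasHolomorphicCoeffs n f U) (hg : HasHolomorphicCoeffs n g U) :
    HasHolomorphicCoeffs n (fun z => f z + g z) U := by
  obtain ⟨c, hc, hf⟩ := hf
  obtain ⟨d, hd, hg⟩ := hg
  refine ⟨fun k z => c k z + d k z, fun k => (hc k).add (hd k), fun z hz => ?_⟩
  simp only [hf z hz, hg z hz, mul_add, Finset.sum_add_distrib]

theorem holomorphic_mul (hf : HasHolomorphicCoeffs n f U) (hh : DifferentiableOn ℂ h U) :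
    HasHolomorphicCoeffs n (fun z => h z * f z) U := by
  obtain ⟨c, hc, hf⟩ := hf
  refine ⟨fun k z => h z * c k z, fun k => hh.mul (hc k), fun z hz => ?_⟩
  simp only [hf z hz, Finset.mul_sum]
  exact Finset.sum_congr rfl fun k _ => by ring

theorem mono {m : ℕ} (hf : HasHolomorphicCoeffs n f U) (hnm : n ≤ m) :
    HasHolomorphicCoeffs m f U := by
  obtain ⟨c, hc, hf⟩ := hf
  refine ⟨fun k => if k < n then c k else 0, fun k => ?_, fun z hz => ?_⟩
  · beta_reduce
    split_ifs
    exacts [hc k, differentiableOn_const 0]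
  · rw [hf z hz, ← Finset.sum_subset (Finset.range_mono hnm)]
    · exact Finset.sum_congr rfl fun k hk => by simp [Finset.mem_range.1 hk]
    · intro k _ hk
      simp [show ¬ k < n by simpa using hk]

theorem conj_mul (hf : HasHolomorphicCoeffs n f U) :
    HasHolomorphicCoeffs (n + 1) (fun z => conj z * f z) U := by
  obtain ⟨c, hc, hf⟩ := hf
  refine ⟨fun k => if k = 0 then 0 else c (k - 1), fun k => ?_, fun z hz => ?_⟩
  · beta_reduce
    split_ifs
    exacts [differentiableOn_const 0, hc _]
  · simp only [hf z hz]
    rw [Finset.sum_range_succ', Finset.mul_sum]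
    simp [pow_succ', mul_assoc]

theorem conj_pow_mul (hf : HasHolomorphicCoeffs n f U) (k : ℕ) :
    HasHolomorphicCoeffs (n + k) (fun z => conj z ^ k * f z) U := by
  induction k with
  | zero => simpa using hf
  | succ k ih => exact ih.conj_mul.congr fun z _ => by simp [pow_succ', mul_assoc]

theorem one_sub_mul_conj_pow_mul (hf : HasHolomorphicCoeffs n f U) (k : ℕ) :
    HasHolomorphicCoeffs (n + k) (fun z => (1 - z * conj z) ^ k * f z) U := by
  induction k with
  | zero => simpa using hf
  | succ k ih =>
    refine ((ih.mono (Nat.le_succ _)).add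
      (ih.conj_mul.holomorphic_mul differentiableOn_id.neg)).congr fun z _ => ?_
    simp
    ring

theorem sum {ι : Type*} (t : Finset ι) {F : ι → ℂ → ℂ}
    (hF : ∀ i ∈ t, HasHolomorphicCoeffs n (F i) U) :
    HasHolomorphicCoeffs n (fun z => ∑ i ∈ t, F i z) U := by
  classical
  induction t using Finset.induction_on with
  | empty => exact ⟨fun _ => 0, fun _ => differentiableOn_const 0, fun z _ => by simp⟩
  | insert i t hi ih =>
    refine ((hF i (Finset.mem_insert_self i t)).add
      (ih fun j hj => hF j (Finset.mem_insert_of_mem hj))).congr fun z _ => ?_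
    simp only [Finset.sum_insert hi]

theorem contDiffOn (hf : HasHolomorphicCoeffs n f U) (hU : IsOpen U) (m : ℕ) :
    ContDiffOn ℝ m f U := by
  obtain ⟨c, hc, hf⟩ := hf
  refine ContDiffOn.congr (ContDiffOn.sum fun k _ => ?_) hf
  exact (contDiff_conj.pow k).contDiffOn.mul (((hc k).contDiffOn hU).restrict_scalars ℝ)

theorem dzbar (hf : HasHolomorphicCoeffs (n + 1) f U) (hU : IsOpen U) :
    HasHolomorphicCoeffs n (dzbar f) U := by
  obtain ⟨c, hc, hf⟩ := hf
  refine ⟨fun k z => (k + 1) * c (k + 1) z, fun k => (hc _).const_mul _, fun z hz => ?_⟩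
  have hd : ∀ k, DifferentiableAt ℂ (c k) z := fun k => (hc k).differentiableAt (hU.mem_nhds hz)
  rw [dzbar_congr hU hf hz, dzbar_sum _ fun k _ => differentiableAt_conj_pow_mul (hd k) k,
    Finset.sum_range_succ', dzbar_conj_pow_mul (hd 0)]
  rw [Nat.cast_zero, zero_mul, zero_mul, add_zero]
  refine Finset.sum_congr rfl fun k _ => ?_
  rw [dzbar_conj_pow_mul (hd _)]
  push_cast
  ring

theorem dzbar_iterate_eq_zero (hf : HasHolomorphicCoeffs n f U) (hU : IsOpen U) :
    ∀ z ∈ U, PolyBergman.dzbar^[n] f z = 0 := by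
  induction n generalizing f with
  | zero =>
    obtain ⟨c, _, hf⟩ := hf
    simpa using hf
  | succ n ih => exact ih (hf.dzbar hU)

end HasHolomorphicCoeffs

/-- The induction step for the structure theorem: if `∂f/∂z̄` has the form in question,
so has `f`. -/
theorem hasHolomorphicCoeffs_of_dzbar {U : Set ℂ} (hU : IsOpen U) {n : ℕ} {f : ℂ → ℂ}
    (hf : DifferentiableOn ℝ f U) (hd : HasHolomorphicCoeffs n (dzbar f) U) :
    HasHolomorphicCoeffs (n + 1) f U := by
  obtain ⟨c, hc, hd⟩ := hd
  -- subtracting an antiderivative of `∂f/∂z̄` in the variable `z̄` leaves a holomorphic function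
  set G : ℂ → ℂ := fun z => ∑ k ∈ Finset.range n, conj z ^ (k + 1) * (c k z / (k + 1)) with hG
  have hG' : HasHolomorphicCoeffs (n + 1) G U := by
    refine ⟨fun k z => if k = 0 then 0 else c (k - 1) z / k, fun k => ?_, fun z hz => ?_⟩
    · by_cases hk : k = 0
      · simp [hk]
      · simpa [hk] using (hc (k - 1)).div_const _
    · rw [Finset.sum_range_succ']
      simp [hG]
  have hcz : ∀ z ∈ U, ∀ k, DifferentiableAt ℂ (fun w => c k w / (k + 1)) z := fun z hz k =>
    ((hc k).differentiableAt (hU.mem_nhds hz)).div_const _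
  have hh : DifferentiableOn ℂ (fun z => f z - G z) U := by
    intro z hz
    have hfz := hf.differentiableAt (hU.mem_nhds hz)
    have hGz : DifferentiableAt ℝ G z :=
      DifferentiableAt.fun_sum fun k _ => differentiableAt_conj_pow_mul (hcz z hz k) (k + 1)
    have hdG : dzbar G z = dzbar f z := by
      rw [hd z hz, hG, dzbar_sum _ fun k _ => differentiableAt_conj_pow_mul (hcz z hz k) (k + 1)]
      refine Finset.sum_congr rfl fun k _ => ?_
      rw [dzbar_conj_pow_mul (hcz z hz k)]
      have : (k : ℂ) + 1 ≠ 0 := Nat.cast_add_one_ne_zero k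
      push_cast
      field_simp
    refine (differentiableAt_complex_iff_differentiableAt_real.2
      ⟨hfz.sub hGz, ?_⟩).differentiableWithinAt
    rw [fderiv_sub hfz hGz]
    simp only [dzbar] at hdG
    simp only [_root_.sub_apply, smul_eq_mul]
    linear_combination (2 * Complex.I) * hdG + (fderiv ℝ f z Complex.I -
      fderiv ℝ G z Complex.I) * Complex.I_mul_I
  refine (hG'.add ((HasHolomorphicCoeffs.of_differentiableOn hh).mono (by omega))).congr
    fun z _ => ?_
  simp

/-- Structure of `n`-analytic functions: they are the polynomials of degree `< n` in `z̄` with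
holomorphic coefficients. -/
theorem isPolyanalyticOn_iff {U : Set ℂ} (hU : IsOpen U) {n : ℕ} {f : ℂ → ℂ} :
    IsPolyanalyticOn n f U ↔ HasHolomorphicCoeffs n f U := by
  refine ⟨fun h => ?_, fun h => ⟨h.contDiffOn hU n, h.dzbar_iterate_eq_zero hU⟩⟩
  induction n generalizing f with
  | zero => exact ⟨fun _ => 0, fun _ => differentiableOn_const 0, by simpa using h.2⟩
  | succ n ih =>
    exact hasHolomorphicCoeffs_of_dzbar hU (h.1.differentiableOn (by simp))
      (ih ⟨contDiffOn_dzbar hU h.1, h.2⟩)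

theorem hasHolomorphicCoeffs_rawPoly_term {q k : ℕ} (hk : k ≤ q) {h : ℂ → ℂ} {U : Set ℂ}
    (hh : DifferentiableOn ℂ h U) :
    HasHolomorphicCoeffs (q + 1) (fun z => h z * conj z ^ (q - k) * (1 - z * conj z) ^ k) U := by
  have := ((HasHolomorphicCoeffs.of_differentiableOn hh).one_sub_mul_conj_pow_mul k).conj_pow_mul
    (q - k)
  rw [show 1 + k + (q - k) = q + 1 by omega] at this
  exact this.congr fun z _ => by ring

theorem hasHolomorphicCoeffs_rawPoly (α : ℝ) (p q : ℕ) (U : Set ℂ) :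
    HasHolomorphicCoeffs (q + 1) (rawPoly α p q) U := by
  refine HasHolomorphicCoeffs.sum _ fun k hk => ?_
  have hk' : k ≤ q := Nat.lt_succ_iff.1 (Finset.mem_range.1 hk)
  refine (hasHolomorphicCoeffs_rawPoly_term hk' (h := fun z => (-1) ^ k *
    ((q.choose k * p.descFactorial k / Real.Gamma (α + k + 1) : ℝ) : ℂ) * z ^ (p - k))
    ((differentiable_pow _).const_mul _).differentiableOn).congr fun z _ => ?_
  ring

/-! ### Integrals of monomials over the disk -/

/-- The monomial `z^a z̄^b`. -/
noncomputable def zmono (a b : ℕ) (z : ℂ) : ℂ := z ^ a * conj z ^ b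

theorem conj_zmono (a b : ℕ) (z : ℂ) : conj (zmono a b z) = zmono b a z := by
  simp [zmono, mul_comm]

theorem zmono_mul_zmono (a b c d : ℕ) (z : ℂ) :
    zmono a b z * zmono c d z = zmono (a + c) (b + d) z := by
  simp only [zmono]; ring

theorem continuous_zmono (a b : ℕ) : Continuous (zmono a b) :=
  (continuous_pow a).mul (Complex.continuous_conj.pow b)

theorem zmono_self (a : ℕ) (z : ℂ) : zmono a a z = (((‖z‖ ^ 2) ^ a : ℝ) : ℂ) := by
  rw [zmono, ← mul_pow, Complex.mul_conj']; push_cast; rfl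

theorem norm_zmono (a b : ℕ) (z : ℂ) : ‖zmono a b z‖ = ‖z‖ ^ (a + b) := by
  simp [zmono, pow_add]

theorem integral_diskMeasure (α : ℝ) (hα : -1 < α) (F : ℂ → ℂ) :
    ∫ z, F z ∂diskMeasure α =
      ∫ z in disk, (((α + 1) / Real.pi * (1 - ‖z‖ ^ 2) ^ α : ℝ) : ℂ) * F z := by
  have hm : Measurable fun z : ℂ => ENNReal.ofReal ((α + 1) / Real.pi * (1 - ‖z‖ ^ 2) ^ α) := by
    fun_prop
  rw [diskMeasure, integral_withDensity_eq_integral_toReal_smul hm (by simp)]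
  refine setIntegral_congr_fun isOpen_disk.measurableSet fun z hz => ?_
  have h0 : 0 ≤ (α + 1) / Real.pi * (1 - ‖z‖ ^ 2) ^ α := by
    have := one_sub_norm_sq_pos hz
    have : 0 < α + 1 := by linarith
    positivity
  simp only [ENNReal.toReal_ofReal h0, Complex.real_smul]

theorem betaIntegrand_integrable {u v : ℝ} (hu : 0 < u) (hv : 0 < v) :
    IntegrableOn (fun t : ℝ => t ^ (u - 1) * (1 - t) ^ (v - 1)) (Set.Ioo 0 1) ∧
      ∫ t in Set.Ioo (0 : ℝ) 1, t ^ (u - 1) * (1 - t) ^ (v - 1) = ProbabilityTheory.beta u v := by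
  have he : Set.EqOn (fun t : ℝ => (t : ℂ) ^ ((u : ℂ) - 1) * (1 - t) ^ ((v : ℂ) - 1))
      (fun t : ℝ => ((t ^ (u - 1) * (1 - t) ^ (v - 1) : ℝ) : ℂ)) (Set.Ioo 0 1) := by
    intro t ht
    have h1 : 0 ≤ 1 - t := by linarith [ht.2]
    simp only
    rw [Complex.ofReal_mul, Complex.ofReal_cpow ht.1.le, Complex.ofReal_cpow h1]
    push_cast
    rfl
  have hc := Complex.betaIntegral_convergent (u := u) (v := v) (by simpa) (by simpa)
  rw [intervalIntegrable_iff_integrableOn_Ioo_of_le zero_le_one,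
    integrableOn_congr_fun he measurableSet_Ioo] at hc
  refine ⟨by simpa [IntegrableOn] using hc.re, ?_⟩
  rw [ProbabilityTheory.beta_eq_betaIntegralReal u v hu hv, Complex.betaIntegral,
    intervalIntegral.integral_of_le zero_le_one, integral_Ioc_eq_integral_Ioo,
    setIntegral_congr_fun measurableSet_Ioo he, integral_complex_ofReal, Complex.ofReal_re]

/-- Integration over the disk of a function of `|z|²`, in the variable `t = |z|²`. -/
theorem integral_disk_radial (φ : ℝ → ℝ) :
    ∫ z in disk, φ (‖z‖ ^ 2) = Real.pi * ∫ t in Set.Ioo (0 : ℝ) 1, φ t := by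
  have h1 := integral_fun_norm_addHaar (volume : Measure ℂ)
    (fun y => (Set.Iio (1 : ℝ)).indicator φ (y ^ 2))
  have h2 := integral_comp_rpow_Ioi_of_pos (g := (Set.Iio (1 : ℝ)).indicator φ) two_pos
  have h3 : ∫ z in disk, φ (‖z‖ ^ 2) =
      ∫ z : ℂ, (Set.Iio (1 : ℝ)).indicator φ (‖z‖ ^ 2) := by
    rw [← integral_indicator isOpen_disk.measurableSet]
    congr 1
    funext z
    by_cases hz : ‖z‖ < 1
    · have hz' : ‖z‖ ^ 2 < 1 := by nlinarith [norm_nonneg z]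
      simp [Set.indicator, disk, hz, hz']
    · simp [Set.indicator, disk, hz]
  have h4 : ∫ y in Set.Ioi (0 : ℝ), (Set.Iio (1 : ℝ)).indicator φ y =
      ∫ t in Set.Ioo (0 : ℝ) 1, φ t := by
    rw [setIntegral_indicator measurableSet_Iio, Set.Ioi_inter_Iio]
  rw [h3, h1, ← h4, ← h2]
  have h5 : (volume : Measure ℂ).real (Metric.ball 0 1) = Real.pi := by
    simp [Measure.real, Complex.volume_ball]
  rw [h5, Complex.finrank_real_complex, nsmul_eq_mul, smul_eq_mul, ← mul_assoc,
    mul_comm ((2 : ℕ) : ℝ), mul_assoc, ← integral_const_mul]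
  congr 1
  refine setIntegral_congr_fun measurableSet_Ioi fun y _ => ?_
  simp only [smul_eq_mul]
  norm_num
  ring

theorem integrableOn_disk_radial {φ : ℝ → ℝ} (hφ : IntegrableOn φ (Set.Ioo (0 : ℝ) 1)) :
    IntegrableOn (fun z : ℂ => φ (‖z‖ ^ 2)) disk := by
  have h3 : (disk.indicator fun z : ℂ => φ (‖z‖ ^ 2)) =
      fun z : ℂ => (Set.Iio (1 : ℝ)).indicator φ (‖z‖ ^ 2) := by
    funext z
    by_cases hz : ‖z‖ < 1
    · have hz' : ‖z‖ ^ 2 < 1 := by nlinarith [norm_nonneg z]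
      simp [Set.indicator, disk, hz, hz']
    · simp [Set.indicator, disk, hz]
  rw [← integrable_indicator_iff isOpen_disk.measurableSet, h3,
    integrable_fun_norm_addHaar volume (f := fun y => (Set.Iio (1 : ℝ)).indicator φ (y ^ 2))]
  have h4 : IntegrableOn ((Set.Iio (1 : ℝ)).indicator φ) (Set.Ioi 0) := by
    rw [IntegrableOn, integrable_indicator_iff measurableSet_Iio, IntegrableOn,
      Measure.restrict_restrict measurableSet_Iio, Set.inter_comm, Set.Ioi_inter_Iio]
    exact hφ
  have h5 := (integrableOn_Ioi_comp_rpow_iff ((Set.Iio (1 : ℝ)).indicator φ)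
    two_ne_zero).2 h4
  refine IntegrableOn.congr_fun (h5.const_mul (1 / 2)) (fun y _ => ?_) measurableSet_Ioi
  simp only [smul_eq_mul, Complex.finrank_real_complex]
  norm_num
  ring

theorem isFiniteMeasure_diskMeasure {α : ℝ} (hα : -1 < α) : IsFiniteMeasure (diskMeasure α) := by
  refine isFiniteMeasure_withDensity_ofReal (Integrable.hasFiniteIntegral ?_)
  refine Integrable.const_mul ?_ _
  refine integrableOn_disk_radial (φ := fun t => (1 - t) ^ α) ?_
  have := (betaIntegrand_integrable (u := 1) (v := α + 1) one_pos (by linarith)).1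
  simpa using this

theorem ae_mem_disk (α : ℝ) : ∀ᵐ z ∂diskMeasure α, z ∈ disk :=
  (withDensity_absolutelyContinuous _ _).ae_le (ae_restrict_mem isOpen_disk.measurableSet)

/-- Euler's beta integral in the form needed for the moments of `rawPoly`. -/
theorem integral_zmono_self_mul {α : ℝ} (hα : -1 < α) (a k : ℕ) :
    ∫ z, zmono a a z * (1 - z * conj z) ^ k ∂diskMeasure α =
      (((α + 1) * (a.factorial * Real.Gamma (α + k + 1) /
        Real.Gamma (a + α + k + 2)) : ℝ) : ℂ) := by
  have hk : (0 : ℝ) ≤ k := k.cast_nonneg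
  have ha : (0 : ℝ) ≤ a := a.cast_nonneg
  have h1 : ∀ z ∈ disk, (((α + 1) / Real.pi * (1 - ‖z‖ ^ 2) ^ α : ℝ) : ℂ) *
      (zmono a a z * (1 - z * conj z) ^ k) =
      (((α + 1) / Real.pi * ((‖z‖ ^ 2) ^ ((a + 1 : ℝ) - 1) *
        (1 - ‖z‖ ^ 2) ^ ((α + k + 1) - 1)) : ℝ) : ℂ) := by
    intro z hz
    rw [zmono_self, Complex.mul_conj', add_sub_cancel_right, add_sub_cancel_right,
      Real.rpow_natCast, Real.rpow_add (one_sub_norm_sq_pos hz), Real.rpow_natCast]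
    push_cast
    ring
  rw [integral_diskMeasure α hα, setIntegral_congr_fun isOpen_disk.measurableSet h1,
    integral_complex_ofReal, integral_const_mul,
    integral_disk_radial (fun t => t ^ ((a + 1 : ℝ) - 1) * (1 - t) ^ ((α + k + 1) - 1)),
    (betaIntegrand_integrable (by linarith) (by linarith)).2, ProbabilityTheory.beta,
    Real.Gamma_nat_eq_factorial, show (a : ℝ) + 1 + (α + k + 1) = a + α + k + 2 by ring]
  congr 1
  field_simp

/-- Rotation invariance: `z^a z̄^b` with `a ≠ b` integrates to zero against every radial
function. -/
theorem integral_zmono_mul_radial {α : ℝ} (hα : -1 < α) {a b : ℕ} (hab : a ≠ b) (φ : ℝ → ℂ) :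
    ∫ z, zmono a b z * φ ‖z‖ ∂diskMeasure α = 0 := by
  -- under a rotation by the angle `π / (a - b)` the integrand changes its sign
  set t : ℝ := Real.pi / ((a : ℝ) - b) with ht
  have hab' : (a : ℝ) - b ≠ 0 := sub_ne_zero.2 (by exact_mod_cast hab)
  set c : Circle := Circle.exp t
  have hc : (c : ℂ) ^ a * conj (c : ℂ) ^ b = -1 := by
    rw [Circle.coe_exp, ← Complex.exp_conj, ← Complex.exp_nat_mul, ← Complex.exp_nat_mul,
      ← Complex.exp_add, ← Complex.exp_pi_mul_I]
    congr 1
    have : (Real.pi : ℂ) = t * ((a : ℂ) - b) := by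
      rw [ht]; push_cast
      have : (a : ℂ) - b ≠ 0 := sub_ne_zero.2 (by exact_mod_cast hab)
      field_simp
    rw [this]
    simp
    ring
  rw [integral_diskMeasure α hα]
  set I := ∫ z in disk, (((α + 1) / Real.pi * (1 - ‖z‖ ^ 2) ^ α : ℝ) : ℂ) * (zmono a b z * φ ‖z‖)
    with hI
  have hpre : (rotation c) ⁻¹' disk = disk := by
    ext z; simp only [disk, Set.mem_preimage, mem_ball_zero_iff, LinearIsometryEquiv.norm_map]
  have h1 := ((rotation c).measurePreserving.setIntegral_preimage_emb
    (rotation c).toHomeomorph.measurableEmbedding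
    (fun z => (((α + 1) / Real.pi * (1 - ‖z‖ ^ 2) ^ α : ℝ) : ℂ) * (zmono a b z * φ ‖z‖)) disk)
  rw [hpre, ← hI] at h1
  have h2 : ∀ z : ℂ, (((α + 1) / Real.pi * (1 - ‖rotation c z‖ ^ 2) ^ α : ℝ) : ℂ) *
      (zmono a b (rotation c z) * φ ‖rotation c z‖) =
      -1 * ((((α + 1) / Real.pi * (1 - ‖z‖ ^ 2) ^ α : ℝ) : ℂ) * (zmono a b z * φ ‖z‖)) := by
    intro z
    rw [LinearIsometryEquiv.norm_map, rotation_apply, zmono, zmono, map_mul, mul_pow, mul_pow,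
      ← hc]
    ring
  simp only [h2] at h1
  rw [integral_const_mul, ← hI] at h1
  have : (2 : ℂ) * I = 0 := by linear_combination -h1
  simpa using this

/-! ### Moments and orthogonality of the disk polynomials -/

theorem continuous_rawPoly (α : ℝ) (p q : ℕ) : Continuous (rawPoly α p q) := by
  unfold rawPoly
  fun_prop

theorem exists_norm_le_on_disk {f : ℂ → ℂ} (hf : Continuous f) : ∃ C, ∀ z ∈ disk, ‖f z‖ ≤ C := by
  obtain ⟨C, hC⟩ := (isCompact_closedBall (0 : ℂ) 1).exists_bound_of_continuousOn hf.continuousOn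
  exact ⟨C, fun z hz => hC z (Metric.ball_subset_closedBall hz)⟩

theorem integrable_mul_continuous {α : ℝ} {g h : ℂ → ℂ} (hg : Integrable g (diskMeasure α))
    (hh : Continuous h) : Integrable (fun z => g z * h z) (diskMeasure α) := by
  obtain ⟨C, hC⟩ := exists_norm_le_on_disk hh
  exact hg.mul_bdd hh.aestronglyMeasurable ((ae_mem_disk α).mono hC)

theorem integrable_of_continuous {α : ℝ} (hα : -1 < α) {h : ℂ → ℂ} (hh : Continuous h) :
    Integrable h (diskMeasure α) := by
  have := isFiniteMeasure_diskMeasure hα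
  simpa using integrable_mul_continuous (integrable_const (1 : ℂ)) hh

/-- The `q`-th forward difference of `x ↦ x.choose b` at `a`, for `b ≤ q`. -/
theorem sum_neg_one_pow_choose_mul_choose (a : ℕ) {b q : ℕ} (hb : b ≤ q) :
    ∑ k ∈ Finset.range (q + 1), (-1 : ℤ) ^ k * (q.choose k * (a + (q - k)).choose b) =
      if b = q then 1 else 0 := by
  have h1 := fwdDiff_iter_eq_sum_shift 1 (fun x : ℕ => (x.choose b : ℤ)) q a
  rw [← Finset.sum_range_reflect] at h1
  have h2 : (fwdDiff 1)^[q] (fun x : ℕ => (x.choose b : ℤ)) a = if b = q then 1 else 0 := by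
    have h0 : (fwdDiff 1)^[b] (fun x : ℕ => (x.choose b : ℤ)) = fun _ => 1 := by
      simpa using fwdDiff_iter_choose 0 b
    obtain ⟨d, rfl⟩ := Nat.exists_eq_add_of_le' hb
    rw [Function.iterate_add_apply, h0]
    rcases Nat.eq_zero_or_pos d with rfl | hd
    · simp
    · obtain ⟨e, rfl⟩ := Nat.exists_eq_add_of_le' hd
      have hz : ∀ e : ℕ, (fwdDiff 1)^[e] (fun _ : ℕ => (0 : ℤ)) = fun _ => 0 := by
        intro e
        induction e with
        | zero => rfl
        | succ e ih => rw [Function.iterate_succ_apply, fwdDiff_const, ih]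
      rw [Function.iterate_succ_apply, fwdDiff_const, hz, if_neg (by omega)]
  rw [← h2, h1]
  refine Finset.sum_congr rfl fun k hk => ?_
  have hk' : k ≤ q := Nat.lt_succ_iff.1 (Finset.mem_range.1 hk)
  rw [show q + 1 - 1 - k = q - k by omega, show q - (q - k) = k by omega, Nat.choose_symm hk']
  simp [mul_assoc]

theorem integral_rawPoly_mul {α : ℝ} (p q : ℕ) {g : ℂ → ℂ}
    (hg : Integrable g (diskMeasure α)) :
    ∫ z, g z * rawPoly α p q z ∂diskMeasure α = ∑ k ∈ Finset.range (q + 1), (-1) ^ k *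
      ((q.choose k * p.descFactorial k / Real.Gamma (α + k + 1) : ℝ) : ℂ) *
      ∫ z, g z * (zmono (p - k) (q - k) z * (1 - z * conj z) ^ k) ∂diskMeasure α := by
  simp only [rawPoly, Finset.mul_sum]
  rw [integral_finsetSum]
  · refine Finset.sum_congr rfl fun k _ => ?_
    rw [← integral_const_mul]
    congr 1
    funext z
    simp only [zmono]
    ring
  · intro k _
    refine integrable_mul_continuous hg ?_
    fun_prop

theorem integral_zmono_mul_rawPoly_of_ne {α : ℝ} (hα : -1 < α) {a b p q : ℕ}
    (h : a + q ≠ p + b) :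
    ∫ z, zmono b a z * rawPoly α p q z ∂diskMeasure α = 0 := by
  rw [integral_rawPoly_mul p q (integrable_of_continuous hα (continuous_zmono b a))]
  refine Finset.sum_eq_zero fun k hk => ?_
  have hk' : k ≤ q := Nat.lt_succ_iff.1 (Finset.mem_range.1 hk)
  rcases lt_or_ge p k with hp | hp
  · simp [Nat.descFactorial_eq_zero_iff_lt.2 hp]
  · have := integral_zmono_mul_radial hα (a := b + (p - k)) (b := a + (q - k)) (by omega)
      (fun r => ((1 - r ^ 2 : ℝ) : ℂ) ^ k)
    simp only [← mul_assoc, zmono_mul_zmono, one_sub_mul_conj_eq, this, mul_zero]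

/-- The moments of `rawPoly α p q` along the diagonal `a - b = p - q`, up to the leading one.
The summands are proportional to `(-1)^k C(q,k) C(a+q-k, b)`; for `p < k` this binomial coefficient
vanishes, as does the corresponding term of `rawPoly`. -/
theorem integral_zmono_mul_rawPoly {α : ℝ} (hα : -1 < α) {a b p q : ℕ}
    (h : a + q = p + b) (hb : b ≤ q) :
    ∫ z, zmono b a z * rawPoly α p q z ∂diskMeasure α =
      if b = q then (((α + 1) * (p.factorial * q.factorial) /
        Real.Gamma (p + q + α + 2) : ℝ) : ℂ) else 0 := by
  rw [integral_rawPoly_mul p q (integrable_of_continuous hα (continuous_zmono b a))]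
  have hterm : ∀ k ∈ Finset.range (q + 1), (-1) ^ k *
      ((q.choose k * p.descFactorial k / Real.Gamma (α + k + 1) : ℝ) : ℂ) *
      ∫ z, zmono b a z * (zmono (p - k) (q - k) z * (1 - z * conj z) ^ k) ∂diskMeasure α =
      (((α + 1) * (p.factorial * b.factorial) / Real.Gamma (p + b + α + 2) : ℝ) : ℂ) *
        (((-1 : ℤ) ^ k * (q.choose k * (a + (q - k)).choose b) : ℤ) : ℂ) := by
    intro k hk
    have hk' : k ≤ q := Nat.lt_succ_iff.1 (Finset.mem_range.1 hk)
    rcases lt_or_ge p k with hp | hp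
    · simp [Nat.descFactorial_eq_zero_iff_lt.2 hp,
        Nat.choose_eq_zero_of_lt (show a + (q - k) < b by omega)]
    · have := integral_zmono_self_mul hα (b + (p - k)) k
      have hΓ := (Gamma_shift_pos hα k).ne'
      have e1 : ((b + (p - k) : ℕ) : ℝ) + α + k + 2 = p + b + α + 2 := by
        push_cast [Nat.cast_sub hp]; ring
      have e2 : (p.descFactorial k : ℝ) * (b + (p - k)).factorial =
          p.factorial * b.factorial * (a + (q - k)).choose b := by
        have h1 := Nat.factorial_mul_descFactorial hp
        have h2 := Nat.add_choose_mul_factorial_mul_factorial b (p - k)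
        rw [show a + (q - k) = b + (p - k) by omega]
        norm_cast
        rw [← h1, ← h2, Nat.choose_symm_add]
        ring
      simp only [← mul_assoc, zmono_mul_zmono]
      rw [show a + (q - k) = b + (p - k) by omega, this, e1]
      rw [show a + (q - k) = b + (p - k) by omega] at e2
      have e3 : (q.choose k * p.descFactorial k / Real.Gamma (α + k + 1)) *
          ((α + 1) * (((b + (p - k)).factorial : ℝ) * Real.Gamma (α + k + 1) /
            Real.Gamma (p + b + α + 2))) =
          ((α + 1) * (p.factorial * b.factorial) / Real.Gamma (p + b + α + 2)) *
            (q.choose k * (b + (p - k)).choose b) := by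
        field_simp
        linear_combination (q.choose k * (α + 1) / Real.Gamma (p + b + α + 2)) * e2
      rw [mul_assoc, ← Complex.ofReal_mul, e3]
      push_cast
      ring
  rw [Finset.sum_congr rfl hterm, ← Finset.mul_sum, ← Int.cast_sum,
    sum_neg_one_pow_choose_mul_choose a hb]
  split_ifs with hbq
  · rw [hbq]; simp
  · simp

/-- If `g` is orthogonal to the lower monomials, then `z^(p-k) z̄^(q-k) (1 - z z̄)^k` may be
replaced by its leading term when integrated against `g`. -/
theorem integral_mul_zmono_mul_one_sub_pow {α : ℝ} {g : ℂ → ℂ}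
    (hg : Integrable g (diskMeasure α)) {p q k : ℕ} (hp : k ≤ p) (hq : k ≤ q)
    (h0 : ∀ j, 1 ≤ j → j ≤ p → j ≤ q → ∫ z, g z * zmono (p - j) (q - j) z ∂diskMeasure α = 0) :
    ∫ z, g z * (zmono (p - k) (q - k) z * (1 - z * conj z) ^ k) ∂diskMeasure α =
      (-1) ^ k * ∫ z, g z * zmono p q z ∂diskMeasure α := by
  have h1 : ∀ z, g z * (zmono (p - k) (q - k) z * (1 - z * conj z) ^ k) =
      ∑ i ∈ Finset.range (k + 1), ((-1) ^ i * (k.choose i : ℂ)) *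
        (g z * zmono (p - k + i) (q - k + i) z) := by
    intro z
    rw [sub_eq_neg_add, add_pow, Finset.mul_sum, Finset.mul_sum]
    refine Finset.sum_congr rfl fun i _ => ?_
    simp only [zmono, one_pow, neg_pow (z * conj z), mul_pow]
    ring
  simp only [h1]
  rw [integral_finsetSum _ fun i _ =>
    (integrable_mul_continuous hg (continuous_zmono _ _)).const_mul _,
    Finset.sum_range_succ, Finset.sum_eq_zero]
  · rw [integral_const_mul, Nat.sub_add_cancel hp, Nat.sub_add_cancel hq]
    simp
  · intro i hi
    have hi' : i < k := Finset.mem_range.1 hi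
    rw [integral_const_mul, show p - k + i = p - (k - i) by omega,
      show q - k + i = q - (k - i) by omega, h0 (k - i) (by omega) (by omega) (by omega), mul_zero]

/-- The coefficient of `z^p z̄^q` in `rawPoly α p q`, by the Chu-Vandermonde identity. -/
theorem sum_rawPoly_coeff {α : ℝ} (hα : -1 < α) (p q : ℕ) :
    ∑ k ∈ Finset.range (q + 1), (q.choose k * p.descFactorial k / Real.Gamma (α + k + 1)) =
      Real.Gamma (p + q + α + 1) / (Real.Gamma (α + p + 1) * Real.Gamma (α + q + 1)) := by
  have hΓp := (Gamma_shift_pos hα p).ne'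
  have hΓq := (Gamma_shift_pos hα q).ne'
  have h1 : ∀ k ∈ Finset.range (q + 1), (q.choose k * p.descFactorial k / Real.Gamma (α + k + 1)) =
      (q.factorial / Real.Gamma (α + q + 1)) *
        (Ring.choose (p : ℝ) k * Ring.choose ((q : ℝ) + α) (q - k)) := by
    intro k hk
    have hk' : k ≤ q := Nat.lt_succ_iff.1 (Finset.mem_range.1 hk)
    have h2 := choose_mul_factorial_div_Gamma hα hk'
    rw [Nat.descFactorial_eq_factorial_mul_choose] at h2
    rw [Ring.choose_natCast, Nat.descFactorial_eq_factorial_mul_choose]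
    push_cast at h2 ⊢
    linear_combination (-(p.choose k : ℝ)) * h2
  have h3 : (descPochhammer ℝ q).eval ((p : ℝ) + (q + α)) * Real.Gamma (α + p + 1) =
      Real.Gamma (p + q + α + 1) := by
    have e : (p : ℝ) + (q + α) - q + 1 = α + p + 1 := by ring
    have h : 0 < (p : ℝ) + (q + α) - q + 1 := by
      have : (0 : ℝ) ≤ p := p.cast_nonneg
      linarith
    have := descPochhammer_eval_mul_Gamma h
    rwa [e, show (p : ℝ) + (q + α) + 1 = p + q + α + 1 by ring] at this
  rw [Finset.sum_congr rfl h1, ← Finset.mul_sum, ← Finset.Nat.sum_antidiagonal_eq_sum_range_succ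
    (fun i j => Ring.choose (p : ℝ) i * Ring.choose ((q : ℝ) + α) j) q,
    ← Ring.add_choose_eq q (Commute.all _ _), ← h3, descPochhammer_eval_eq_factorial_mul_choose]
  field_simp

/-- If `g` is orthogonal to all lower monomials with the same `p - q`, then only the leading
monomial of `rawPoly α p q` contributes to its integral against `g`. -/
theorem integral_mul_rawPoly_eq {α : ℝ} (hα : -1 < α) {g : ℂ → ℂ}
    (hg : Integrable g (diskMeasure α)) {p q : ℕ}
    (h0 : ∀ j, 1 ≤ j → j ≤ p → j ≤ q → ∫ z, g z * zmono (p - j) (q - j) z ∂diskMeasure α = 0) :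
    ∫ z, g z * rawPoly α p q z ∂diskMeasure α =
      ((Real.Gamma (p + q + α + 1) / (Real.Gamma (α + p + 1) * Real.Gamma (α + q + 1)) : ℝ) : ℂ) *
        ∫ z, g z * zmono p q z ∂diskMeasure α := by
  rw [integral_rawPoly_mul p q hg, ← sum_rawPoly_coeff hα, Complex.ofReal_sum, Finset.sum_mul]
  refine Finset.sum_congr rfl fun k hk => ?_
  have hk' : k ≤ q := Nat.lt_succ_iff.1 (Finset.mem_range.1 hk)
  rcases lt_or_ge p k with hp | hp
  · simp [Nat.descFactorial_eq_zero_iff_lt.2 hp]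
  · rw [integral_mul_zmono_mul_one_sub_pow hg hp hk' h0]
    have : (-1 : ℂ) ^ k * (-1) ^ k = 1 := by rw [← mul_pow]; simp
    linear_combination ((q.choose k * p.descFactorial k / Real.Gamma (α + k + 1) : ℝ) : ℂ) *
      (∫ z, g z * zmono p q z ∂diskMeasure α) * this

theorem integral_conj_rawPoly_mul_zmono {α : ℝ} (p q a b : ℕ) :
    ∫ z, conj (rawPoly α p q z) * zmono a b z ∂diskMeasure α =
      conj (∫ z, zmono b a z * rawPoly α p q z ∂diskMeasure α) := by
  rw [← integral_conj]
  congr 1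
  funext z
  rw [map_mul, conj_zmono, mul_comm]

theorem integral_conj_rawPoly_mul_zmono_eq_zero {α : ℝ} (hα : -1 < α) {p q a b : ℕ}
    (h : a + q ≠ p + b ∨ b < q) :
    ∫ z, conj (rawPoly α p q z) * zmono a b z ∂diskMeasure α = 0 := by
  rw [integral_conj_rawPoly_mul_zmono]
  by_cases h1 : a + q = p + b
  · have hb : b < q := h.resolve_left (not_not.2 h1)
    rw [integral_zmono_mul_rawPoly hα h1 hb.le, if_neg hb.ne, map_zero]
  · rw [integral_zmono_mul_rawPoly_of_ne hα h1, map_zero]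

theorem integrable_conj_rawPoly {α : ℝ} (hα : -1 < α) (p q : ℕ) :
    Integrable (fun z => conj (rawPoly α p q z)) (diskMeasure α) :=
  integrable_of_continuous hα (Complex.continuous_conj.comp (continuous_rawPoly α p q))

theorem integral_conj_rawPoly_mul_rawPoly_of_lt {α : ℝ} (hα : -1 < α) {p q p' q' : ℕ}
    (h : p + q' ≠ p' + q ∨ q < q') :
    ∫ z, conj (rawPoly α p' q' z) * rawPoly α p q z ∂diskMeasure α = 0 := by
  rw [integral_mul_rawPoly_eq hα (integrable_conj_rawPoly hα p' q'),
    integral_conj_rawPoly_mul_zmono_eq_zero hα h, mul_zero]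
  intro j _ hp hq
  exact integral_conj_rawPoly_mul_zmono_eq_zero hα (by omega)

theorem integral_conj_rawPoly_mul_rawPoly_of_ne {α : ℝ} (hα : -1 < α) {p q p' q' : ℕ}
    (h : (p', q') ≠ (p, q)) :
    ∫ z, conj (rawPoly α p' q' z) * rawPoly α p q z ∂diskMeasure α = 0 := by
  by_cases h1 : p + q' ≠ p' + q ∨ q < q'
  · exact integral_conj_rawPoly_mul_rawPoly_of_lt hα h1
  · have h2 : p' + q ≠ p + q' ∨ q' < q := by
      simp only [ne_eq, Prod.mk.injEq] at h
      omega
    have h3 := congrArg conj (integral_conj_rawPoly_mul_rawPoly_of_lt hα h2)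
    rw [← integral_conj, map_zero] at h3
    rw [← h3]
    congr 1
    funext z
    simp [mul_comm]

theorem integral_conj_rawPoly_mul_self {α : ℝ} (hα : -1 < α) (p q : ℕ) :
    ((rawNorm α p q ^ 2 : ℝ) : ℂ) *
      ∫ z, conj (rawPoly α p q z) * rawPoly α p q z ∂diskMeasure α = 1 := by
  have hp := Gamma_shift_pos hα p
  have hq := Gamma_shift_pos hα q
  have hpq := Gamma_shift_pos hα (p + q)
  have h0 : 0 < α + 1 := by linarith
  have h1 : 0 < (p : ℝ) + q + α + 1 := by
    have : (0 : ℝ) ≤ p := p.cast_nonneg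
    have : (0 : ℝ) ≤ q := q.cast_nonneg
    linarith
  rw [integral_mul_rawPoly_eq hα (integrable_conj_rawPoly hα p q),
    integral_conj_rawPoly_mul_zmono, integral_zmono_mul_rawPoly hα rfl le_rfl, if_pos rfl,
    Complex.conj_ofReal, ← Complex.ofReal_mul, ← Complex.ofReal_mul, ← Complex.ofReal_one]
  · congr 1
    have e : Real.Gamma (p + q + α + 2) = (p + q + α + 1) * Real.Gamma (p + q + α + 1) := by
      rw [← Real.Gamma_add_one h1.ne']; ring_nf
    have e2 : Real.Gamma (p + q + α + 1) = Real.Gamma (α + (p + q : ℕ) + 1) := by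
      push_cast; ring_nf
    have e3 : α + p + q + 1 = p + q + α + 1 := by ring
    rw [rawNorm, Real.sq_sqrt, e, e2, e3]
    · field_simp
    · rw [e3]; positivity
  · intro j h1 _ hq
    exact integral_conj_rawPoly_mul_zmono_eq_zero hα (by omega)

/-! ### Uniqueness: `n`-analytic functions are determined by their moments -/

theorem setIntegral_ball_zmono {α : ℝ} (hα : -1 < α) (r : ℝ) {a b : ℕ} (hab : a ≠ b) :
    ∫ z in Metric.ball 0 r, zmono a b z ∂diskMeasure α = 0 := by
  rw [← integral_indicator measurableSet_ball]
  refine (integral_congr_ae (Filter.Eventually.of_forall ?_)).trans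
    (integral_zmono_mul_radial hα hab ((Set.Iio r).indicator 1))
  intro z
  by_cases hz : ‖z‖ < r <;> simp [Set.indicator, hz]

/-- Integrating a power series over a smaller disk singles out one coefficient. -/
theorem setIntegral_ball_zmono_mul_powerSeries {α : ℝ} (hα : -1 < α) {g : ℂ → ℂ} {c : ℕ → ℂ}
    (hg : ∀ z ∈ disk, HasSum (fun j => c j * z ^ j) (g z)) {r : ℝ} (hr0 : 0 ≤ r) (hr1 : r < 1)
    (b N : ℕ) :
    ∫ z in Metric.ball 0 r, zmono b N z * g z ∂diskMeasure α =
      if b ≤ N then c (N - b) * ∫ z in Metric.ball 0 r, zmono N N z ∂diskMeasure α else 0 := by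
  have := isFiniteMeasure_diskMeasure hα
  have hsum : Summable fun j => ‖c j‖ * r ^ j := by
    have h1 := (hg r (by simpa [disk, abs_of_nonneg hr0] using hr1)).summable.norm
    refine h1.congr fun j => ?_
    simp [abs_of_nonneg hr0]
  have hball : ∀ᵐ z ∂(diskMeasure α).restrict (Metric.ball 0 r), ‖z‖ < r ∧ z ∈ disk := by
    filter_upwards [ae_restrict_mem measurableSet_ball,
      ae_restrict_of_ae (ae_mem_disk α)] with z hz hz'
    exact ⟨by simpa using hz, hz'⟩
  have hs := hasSum_integral_of_dominated_convergence
    (μ := (diskMeasure α).restrict (Metric.ball 0 r))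
    (F := fun j z => zmono b N z * (c j * z ^ j)) (f := fun z => zmono b N z * g z)
    (fun j _ => ‖c j‖ * r ^ j)
    (fun j => ((continuous_zmono b N).mul
      (continuous_const.mul (continuous_pow j))).aestronglyMeasurable)
    (fun j => by
      filter_upwards [hball] with z hz
      rw [norm_mul, norm_mul, norm_pow, norm_zmono]
      have h1 : ‖z‖ ^ (b + N) ≤ 1 := pow_le_one₀ (norm_nonneg z) (hz.1.trans hr1).le
      have h2 : ‖z‖ ^ j ≤ r ^ j := pow_le_pow_left₀ (norm_nonneg z) hz.1.le j
      calc ‖z‖ ^ (b + N) * (‖c j‖ * ‖z‖ ^ j) ≤ 1 * (‖c j‖ * r ^ j) := by gcongr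
        _ = ‖c j‖ * r ^ j := one_mul _)
    (Filter.Eventually.of_forall fun _ => hsum) (integrable_const _)
    (by
      filter_upwards [hball] with z hz
      exact (hg z hz.2).mul_left _)
  have hterm : ∀ j, ∫ z in Metric.ball 0 r, zmono b N z * (c j * z ^ j) ∂diskMeasure α =
      c j * ∫ z in Metric.ball 0 r, zmono (b + j) N z ∂diskMeasure α := by
    intro j
    rw [← integral_const_mul]
    congr 1
    funext z
    simp only [zmono]
    ring
  simp only [hterm] at hs
  split_ifs with h
  · have h1 := hasSum_single (f := fun j => c j * ∫ z in Metric.ball 0 r,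
      zmono (b + j) N z ∂diskMeasure α) (N - b) (fun j hj => by
        simp only [setIntegral_ball_zmono hα r (show b + j ≠ N by omega), mul_zero])
    rw [hs.unique h1, Nat.add_sub_cancel' h]
  · refine hs.unique ?_
    convert hasSum_zero using 2 with j
    rw [setIntegral_ball_zmono hα r (show b + j ≠ N by omega), mul_zero]

theorem tendsto_setIntegral_ball {α : ℝ} {F : ℂ → ℂ} (hF : Integrable F (diskMeasure α)) :
    Filter.Tendsto (fun j : ℕ => ∫ z in Metric.ball 0 (1 - 1 / ((j : ℝ) + 1)), F z ∂diskMeasure α)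
      Filter.atTop (nhds (∫ z, F z ∂diskMeasure α)) := by
  have hU : ⋃ j : ℕ, Metric.ball (0 : ℂ) (1 - 1 / ((j : ℝ) + 1)) = disk := by
    ext z
    simp only [Set.mem_iUnion, mem_ball_zero_iff, disk]
    constructor
    · rintro ⟨j, hj⟩
      have : (0 : ℝ) < 1 / ((j : ℝ) + 1) := by positivity
      linarith
    · intro hz
      obtain ⟨j, hj⟩ := exists_nat_one_div_lt (sub_pos.2 hz)
      exact ⟨j, by linarith⟩
  have h := tendsto_setIntegral_of_monotone (μ := diskMeasure α) (f := F)
    (s := fun j : ℕ => Metric.ball (0 : ℂ) (1 - 1 / ((j : ℝ) + 1))) (fun _ => measurableSet_ball)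
    (fun i j hij => Metric.ball_subset_ball (by
      have : (i : ℝ) ≤ j := by exact_mod_cast hij
      have := one_div_le_one_div_of_le (by positivity : (0 : ℝ) < (i : ℝ) + 1)
        (by linarith : (i : ℝ) + 1 ≤ j + 1)
      linarith)) hF.integrableOn
  rw [hU] at h
  rwa [setIntegral_eq_integral_of_ae_compl_eq_zero] at h
  filter_upwards [ae_mem_disk α] with z hz hz'
  exact absurd hz hz'

/-- The density of `diskMeasure α` is positive on the disk, so continuous functions that agree
almost everywhere agree on the disk. -/
theorem eqOn_disk_of_ae_eq {α : ℝ} (hα : -1 < α) {f g : ℂ → ℂ} (h : f =ᵐ[diskMeasure α] g)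
    (hf : ContinuousOn f disk) (hg : ContinuousOn g disk) : Set.EqOn f g disk := by
  have hac : volume.restrict disk ≪ diskMeasure α := by
    refine withDensity_absolutelyContinuous' (by fun_prop) ?_
    filter_upwards [ae_restrict_mem isOpen_disk.measurableSet] with z hz
    have := one_sub_norm_sq_pos hz
    have : 0 < α + 1 := by linarith
    rw [ne_eq, ENNReal.ofReal_eq_zero, not_le]
    positivity
  refine Measure.eqOn_of_ae_eq (hac.ae_eq h) hf hg ?_
  rw [isOpen_disk.interior_eq]
  exact subset_closure

/-- The measures `t^s dμ`, `t = |z|²`, have positive definite Hankel moment matrices. -/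
theorem eq_zero_of_hankel {α : ℝ} (hα : -1 < α) (s m : ℕ) (A : ℕ → ℂ)
    (h : ∀ i' < m, ∑ i ∈ Finset.range m, A i *
      ∫ z, zmono (s + i + i') (s + i + i') z ∂diskMeasure α = 0) :
    ∀ i < m, A i = 0 := by
  set H : ℂ → ℂ := fun z => ∑ i ∈ Finset.range m, A i * zmono i i z with hH
  have hHc : Continuous H := by
    refine continuous_finsetSum _ fun i _ => continuous_const.mul (continuous_zmono i i)
  have hexp : ∀ z, ((((‖z‖ ^ 2) ^ s * ‖H z‖ ^ 2 : ℝ)) : ℂ) = ∑ i' ∈ Finset.range m,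
      ∑ i ∈ Finset.range m, (conj (A i') * A i) * zmono (s + i + i') (s + i + i') z := by
    intro z
    have h1 : ((((‖z‖ ^ 2) ^ s * ‖H z‖ ^ 2 : ℝ)) : ℂ) = zmono s s z * (conj (H z) * H z) := by
      rw [zmono_self, Complex.conj_mul']
      push_cast
      rfl
    rw [h1, hH]
    simp only [map_sum, map_mul, conj_zmono, Finset.sum_mul_sum]
    rw [Finset.mul_sum]
    refine Finset.sum_congr rfl fun i' _ => ?_
    rw [Finset.mul_sum]
    refine Finset.sum_congr rfl fun i _ => ?_
    rw [← zmono_mul_zmono, ← zmono_mul_zmono]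
    ring
  have hint : ∫ z, (((‖z‖ ^ 2) ^ s * ‖H z‖ ^ 2 : ℝ) : ℂ) ∂diskMeasure α = 0 := by
    simp only [hexp]
    have hi : ∀ i i', Integrable (fun z => (conj (A i') * A i) *
        zmono (s + i + i') (s + i + i') z) (diskMeasure α) := fun i i' =>
      (integrable_of_continuous hα (continuous_zmono _ _)).const_mul _
    rw [integral_finsetSum _ fun i' _ => integrable_finsetSum _ fun i _ => hi i i']
    refine Finset.sum_eq_zero fun i' hi' => ?_
    rw [integral_finsetSum _ fun i _ => hi i i']
    simp only [integral_const_mul, mul_assoc]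
    rw [← Finset.mul_sum, h i' (Finset.mem_range.1 hi'), mul_zero]
  have hcont : Continuous fun z : ℂ => (‖z‖ ^ 2) ^ s * ‖H z‖ ^ 2 := by fun_prop
  have hae : (fun z : ℂ => (((‖z‖ ^ 2) ^ s * ‖H z‖ ^ 2 : ℝ) : ℂ)) =ᵐ[diskMeasure α] 0 := by
    rw [integral_complex_ofReal, Complex.ofReal_eq_zero,
      integral_eq_zero_iff_of_nonneg (fun z => by positivity)] at hint
    · filter_upwards [hint] with z hz
      rw [hz]
      simp
    · exact (integrable_of_continuous hα (Complex.continuous_ofReal.comp hcont)).re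
  have hzero := eqOn_disk_of_ae_eq hα hae (Complex.continuous_ofReal.comp hcont).continuousOn
    continuousOn_const
  set P : Polynomial ℂ := ∑ i ∈ Finset.range m, Polynomial.C (A i) * Polynomial.X ^ i with hP
  have hP0 : P = 0 := by
    refine Polynomial.eq_zero_of_infinite_isRoot P (Set.Infinite.mono ?_
      ((Set.Ioo_infinite (zero_lt_one' ℝ)).image Complex.ofReal_injective.injOn))
    rintro _ ⟨t, ht, rfl⟩
    have hn : ‖((Real.sqrt t : ℝ) : ℂ)‖ ^ 2 = t := by
      rw [Complex.norm_real, Real.norm_eq_abs, sq_abs, Real.sq_sqrt ht.1.le]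
    have hd : ((Real.sqrt t : ℝ) : ℂ) ∈ disk := by
      have : ‖((Real.sqrt t : ℝ) : ℂ)‖ ^ 2 < 1 := by rw [hn]; exact ht.2
      rw [disk, mem_ball_zero_iff]
      exact (sq_lt_one_iff₀ (norm_nonneg _)).1 this
    have hz := hzero hd
    simp only [hn, Pi.zero_apply, Complex.ofReal_eq_zero, mul_eq_zero,
      pow_eq_zero_iff two_ne_zero, norm_eq_zero] at hz
    have hz' := hz.resolve_left (pow_pos ht.1 s).ne'
    simp only [hH, zmono_self, hn] at hz'
    simp only [Set.mem_ofPred_eq, Polynomial.IsRoot, hP, Polynomial.eval_finsetSum,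
      Polynomial.eval_mul, Polynomial.eval_C, Polynomial.eval_pow, Polynomial.eval_X]
    rw [← hz']
    push_cast
    rfl
  intro i hi
  have := congrArg (fun Q => Polynomial.coeff Q i) hP0
  simpa [hP, Polynomial.finsetSum_coeff, Polynomial.coeff_C_mul, Polynomial.coeff_X_pow, hi]
    using this

/-- Orthogonality to `rawPoly α p q` for all `q < n` passes to monomials, since the system is
triangular along each diagonal `p - q = const`. -/
theorem integral_mul_zmono_eq_zero {α : ℝ} (hα : -1 < α) {n : ℕ} {g : ℂ → ℂ}
    (hg : Integrable g (diskMeasure α))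
    (h : ∀ p, ∀ q < n, ∫ z, g z * rawPoly α p q z ∂diskMeasure α = 0) :
    ∀ p, ∀ q < n, ∫ z, g z * zmono p q z ∂diskMeasure α = 0 := by
  intro p q
  induction q using Nat.strong_induction_on generalizing p with
  | _ q ih =>
    intro hq
    have h1 := h p q hq
    rw [integral_mul_rawPoly_eq hα hg fun j hj1 _ hj2 =>
      ih (q - j) (by omega) (p - j) (by omega)] at h1
    have hpq := Gamma_shift_pos hα (p + q)
    push_cast at hpq
    rw [show α + ((p : ℝ) + q) + 1 = p + q + α + 1 by ring] at hpq
    have hD := (div_pos hpq (mul_pos (Gamma_shift_pos hα p) (Gamma_shift_pos hα q))).ne'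
    exact (mul_eq_zero.1 h1).resolve_left (by exact_mod_cast hD)

/-- An integrable `n`-analytic function orthogonal to all disk polynomials with `q < n` vanishes. -/
theorem eqOn_zero_of_integral_eq_zero {α : ℝ} (hα : -1 < α) {n : ℕ} {f : ℂ → ℂ}
    (hf : HasHolomorphicCoeffs n f disk) (hfi : Integrable f (diskMeasure α))
    (h : ∀ p, ∀ q < n, ∫ z, conj (f z) * rawPoly α p q z ∂diskMeasure α = 0) :
    Set.EqOn f 0 disk := by
  obtain ⟨g, hg, hfg⟩ := hf
  set c : ℕ → ℕ → ℂ := fun k j => (j.factorial : ℂ)⁻¹ * iteratedDeriv j (g k) 0 with hc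
  have hsum : ∀ k, ∀ z ∈ disk, HasSum (fun j => c k j * z ^ j) (g k z) := by
    intro k z hz
    have := Complex.hasSum_taylorSeries_on_ball (hg k) hz
    simpa [hc, smul_eq_mul, mul_assoc, mul_comm, mul_left_comm] using this
  have hmom : ∀ a, ∀ b < n, ∫ z, f z * zmono b a z ∂diskMeasure α = 0 := by
    intro a b hb
    have h1 := integral_mul_zmono_eq_zero hα (g := fun z => conj (f z))
      (Complex.conjCLE.toContinuousLinearMap.integrable_comp hfi) h a b hb
    have h2 := congrArg conj h1
    rw [← integral_conj, map_zero] at h2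
    simpa [conj_zmono] using h2
  have hgc : ∀ k, ContinuousOn (g k) disk := fun k => (hg k).continuousOn
  -- the coefficients with a given difference `u - v` of the indices are treated together
  have key : ∀ u v m, n = u + m → (u = 0 ∨ v = 0) → ∀ i < m, c (u + i) (v + i) = 0 := by
    intro u v m hn huv
    refine eq_zero_of_hankel hα (u + v) m (fun i => c (u + i) (v + i)) fun i' hi' => ?_
    have hr : ∀ j : ℕ, 0 ≤ 1 - 1 / ((j : ℝ) + 1) ∧ 1 - 1 / ((j : ℝ) + 1) < 1 := by
      intro j
      have h1 : 1 / ((j : ℝ) + 1) ≤ 1 := by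
        rw [div_le_one (by positivity)]
        have : (0 : ℝ) ≤ j := j.cast_nonneg
        linarith
      have h2 : 0 < 1 / ((j : ℝ) + 1) := by positivity
      constructor <;> linarith
    have hball : ∀ r : ℝ, 0 ≤ r → r < 1 →
        ∫ z in Metric.ball 0 r, f z * zmono (u + i') (v + i') z ∂diskMeasure α =
        ∑ i ∈ Finset.range m, c (u + i) (v + i) *
          ∫ z in Metric.ball 0 r, zmono (u + v + i + i') (u + v + i + i') z ∂diskMeasure α := by
      intro r hr0 hr1
      have hsub : Metric.closedBall (0 : ℂ) r ⊆ disk := Metric.closedBall_subset_ball hr1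
      have hint : ∀ k, IntegrableOn (fun z => zmono (u + i') (k + (v + i')) z * g k z)
          (Metric.ball 0 r) (diskMeasure α) := by
        intro k
        have := isFiniteMeasure_diskMeasure hα
        exact (((continuous_zmono _ _).continuousOn.mul ((hgc k).mono hsub)).integrableOn_compact
          (isCompact_closedBall _ _)).mono_set Metric.ball_subset_closedBall
      have h1 : ∫ z in Metric.ball 0 r, f z * zmono (u + i') (v + i') z ∂diskMeasure α =
          ∑ k ∈ Finset.range n, ∫ z in Metric.ball 0 r,
            zmono (u + i') (k + (v + i')) z * g k z ∂diskMeasure α := by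
        rw [← integral_finsetSum _ fun k _ => hint k]
        refine setIntegral_congr_fun measurableSet_ball fun z hz => ?_
        simp only [hfg z (hsub (Metric.ball_subset_closedBall hz)), Finset.sum_mul]
        refine Finset.sum_congr rfl fun k _ => ?_
        simp only [zmono]
        ring
      rw [h1, hn, Finset.sum_range_add, Finset.sum_eq_zero, zero_add]
      · refine Finset.sum_congr rfl fun i _ => ?_
        rw [setIntegral_ball_zmono_mul_powerSeries hα (hsum _) hr0 hr1, if_pos (by omega),
          show u + i + (v + i') - (u + i') = v + i by omega,
          show u + i + (v + i') = u + v + i + i' by omega]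
      · intro k hk
        have hk' := Finset.mem_range.1 hk
        rw [setIntegral_ball_zmono_mul_powerSeries hα (hsum _) hr0 hr1, if_neg (by omega)]
    have ht1 := tendsto_setIntegral_ball
      (integrable_mul_continuous hfi (continuous_zmono (u + i') (v + i')))
    rw [hmom (v + i') (u + i') (by omega)] at ht1
    have ht2 := tendsto_finsetSum (Finset.range m) fun i _ =>
      (tendsto_setIntegral_ball (α := α) (integrable_of_continuous hα
        (continuous_zmono (u + v + i + i') (u + v + i + i')))).const_mul (c (u + i) (v + i))
    simp only [fun j => hball _ (hr j).1 (hr j).2] at ht1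
    exact tendsto_nhds_unique ht2 ht1
  intro z hz
  rw [hfg z hz]
  refine Finset.sum_eq_zero fun k hk => ?_
  have hk' := Finset.mem_range.1 hk
  have h0 : ∀ j, c k j = 0 := by
    intro j
    have := key (k - min k j) (j - min k j) (n - (k - min k j)) (by omega) (by omega) (min k j)
      (by omega)
    rwa [show k - min k j + min k j = k by omega, show j - min k j + min k j = j by omega] at this
  have h1 := hsum k z hz
  simp only [h0, zero_mul] at h1
  rw [h1.unique hasSum_zero, mul_zero]

/-! ### Convergence of expansions in the disk polynomials -/

theorem Gamma_div_factorial_le {α : ℝ} (hα : -1 < α) {N : ℕ} (hN : α ≤ N) (p : ℕ) :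
    Real.Gamma (α + p + 1) / p.factorial ≤ Real.Gamma (α + 1) * ((p : ℝ) + 1) ^ N := by
  induction p with
  | zero => simp
  | succ p ih =>
    have hp : (0 : ℝ) ≤ p := p.cast_nonneg
    have h0 : 0 < α + p + 1 := by linarith
    have hΓ := Gamma_shift_pos hα p
    have hΓ1 : 0 < Real.Gamma (α + 1) := Real.Gamma_pos_of_pos (by linarith)
    have e : Real.Gamma (α + (p + 1 : ℕ) + 1) / (p + 1).factorial =
        (α + p + 1) / (p + 1) * (Real.Gamma (α + p + 1) / p.factorial) := by
      rw [show α + (p + 1 : ℕ) + 1 = (α + p + 1) + 1 by push_cast; ring,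
        Real.Gamma_add_one h0.ne', Nat.factorial_succ]
      push_cast
      field_simp
    -- Bernoulli's inequality compares the two ratios of consecutive terms
    have hb : (α + p + 1) / (p + 1) ≤ (((p : ℝ) + 2) / (p + 1)) ^ N := by
      have h1 := one_add_mul_le_pow (a := 1 / ((p : ℝ) + 1))
        (by have : 0 < 1 / ((p : ℝ) + 1) := by positivity
            linarith) N
      rw [show ((p : ℝ) + 2) / (p + 1) = 1 + 1 / (p + 1) by field_simp; ring]
      refine le_trans ?_ h1
      rw [show (α + p + 1) / (p + 1) = 1 + α * (1 / ((p : ℝ) + 1)) by field_simp; ring]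
      gcongr
    rw [e]
    calc (α + p + 1) / (p + 1) * (Real.Gamma (α + p + 1) / p.factorial)
        ≤ (((p : ℝ) + 2) / (p + 1)) ^ N * (Real.Gamma (α + 1) * ((p : ℝ) + 1) ^ N) := by
          gcongr
      _ = Real.Gamma (α + 1) * (((p + 1 : ℕ) : ℝ) + 1) ^ N := by
          rw [div_pow]
          push_cast
          field_simp
          ring

/-- The normalizing constants grow at most polynomially in `p`. -/
theorem exists_rawNorm_le {α : ℝ} (hα : -1 < α) (q : ℕ) :
    ∃ C : ℝ, ∃ M : ℕ, ∀ p : ℕ, rawNorm α p q ≤ C * ((p : ℝ) + 1) ^ M := by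
  obtain ⟨N, hN⟩ := exists_nat_ge α
  have hq := Gamma_shift_pos hα q
  have h1 : 0 < α + 1 := by linarith
  have hΓ1 : 0 < Real.Gamma (α + 1) := Real.Gamma_pos_of_pos h1
  set D := (α + 1 + q) * Real.Gamma (α + 1) * (Real.Gamma (α + q + 1) /
    ((α + 1) * q.factorial)) + 1 * Real.Gamma (α + 1) * (Real.Gamma (α + q + 1) /
    ((α + 1) * q.factorial)) with hD
  have hD0 : 0 ≤ D := by positivity
  refine ⟨1 + D, N + 1, fun p => ?_⟩
  have hp : (0 : ℝ) ≤ p := p.cast_nonneg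
  have hx : (α + p + q + 1) * Real.Gamma (α + p + 1) * Real.Gamma (α + q + 1) /
      ((α + 1) * p.factorial * q.factorial) ≤ D * ((p : ℝ) + 1) ^ (N + 1) := by
    have hG := Gamma_div_factorial_le hα hN p
    have hGp := Gamma_shift_pos hα p
    calc (α + p + q + 1) * Real.Gamma (α + p + 1) * Real.Gamma (α + q + 1) /
          ((α + 1) * p.factorial * q.factorial)
        = ((α + 1 + q) + p) * (Real.Gamma (α + p + 1) / p.factorial) *
          (Real.Gamma (α + q + 1) / ((α + 1) * q.factorial)) := by field_simp; ring
      _ ≤ ((α + 1 + q) * (p + 1) + 1 * (p + 1)) *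
          (Real.Gamma (α + 1) * ((p : ℝ) + 1) ^ N) *
          (Real.Gamma (α + q + 1) / ((α + 1) * q.factorial)) := by
          gcongr
          · exact le_mul_of_one_le_right (by positivity) (by linarith)
          · linarith
      _ = D * ((p : ℝ) + 1) ^ (N + 1) := by rw [hD]; ring
  have hone : (1 : ℝ) ≤ ((p : ℝ) + 1) ^ (N + 1) := one_le_pow₀ (by linarith)
  have hs : ∀ x : ℝ, Real.sqrt x ≤ 1 + max x 0 := by
    intro x
    rw [Real.sqrt_le_left (by positivity)]
    nlinarith [le_max_left x 0, le_max_right x 0]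
  calc rawNorm α p q ≤ 1 + max _ 0 := hs _
    _ ≤ ((p : ℝ) + 1) ^ (N + 1) + D * ((p : ℝ) + 1) ^ (N + 1) := by
        gcongr
        exact max_le hx (by positivity)
    _ = (1 + D) * ((p : ℝ) + 1) ^ (N + 1) := by ring

theorem rawNorm_nonneg (α : ℝ) (p q : ℕ) : 0 ≤ rawNorm α p q := Real.sqrt_nonneg _

/-- Power series with polynomially bounded coefficients are holomorphic on the disk. The exponents
are shifted by `k`, truncated at `0`, which affects only finitely many terms. -/
theorem differentiableOn_tsum_of_polynomial_growth {d : ℕ → ℂ} {C : ℝ} {M : ℕ}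
    (hd : ∀ p, ‖d p‖ ≤ C * ((p : ℝ) + 1) ^ M) (k : ℕ) :
    DifferentiableOn ℂ (fun z => ∑' p, d p * z ^ (p - k)) disk ∧
      ∀ z ∈ disk, Summable fun p => d p * z ^ (p - k) := by
  have hbound : ∀ r : ℝ, 0 < r → r < 1 → ∃ u : ℕ → ℝ, Summable u ∧
      ∀ p, ∀ z ∈ Metric.ball (0 : ℂ) r, ‖d p * z ^ (p - k)‖ ≤ u p := by
    intro r hr0 hr1
    refine ⟨fun p => (C / r ^ k / r) * ((((p + 1 : ℕ) : ℝ)) ^ M * r ^ (p + 1)),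
      Summable.mul_left _ ?_, fun p z hz => ?_⟩
    · have hs := summable_pow_mul_geometric_of_norm_lt_one M (r := r)
        (by rwa [Real.norm_eq_abs, abs_of_pos hr0])
      exact (summable_nat_add_iff (f := fun p : ℕ => (p : ℝ) ^ M * r ^ p) 1).2 hs
    · have hz' : ‖z‖ ≤ r := by simpa using (mem_ball_zero_iff.1 hz).le
      have h1 : ‖z‖ ^ (p - k) ≤ r ^ p / r ^ k := by
        refine (pow_le_pow_left₀ (norm_nonneg z) hz' _).trans ?_
        rw [le_div_iff₀ (by positivity), ← pow_add]
        exact pow_le_pow_of_le_one hr0.le hr1.le (by omega)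
      have hC : 0 ≤ C * ((p : ℝ) + 1) ^ M := (norm_nonneg _).trans (hd p)
      calc ‖d p * z ^ (p - k)‖ = ‖d p‖ * ‖z‖ ^ (p - k) := by rw [norm_mul, norm_pow]
        _ ≤ (C * ((p : ℝ) + 1) ^ M) * (r ^ p / r ^ k) := by
            gcongr
            exact hd p
        _ = (C / r ^ k / r) * ((((p + 1 : ℕ) : ℝ)) ^ M * r ^ (p + 1)) := by
            push_cast
            field_simp
            ring
  have hr : ∀ z ∈ disk, ∃ r : ℝ, 0 < r ∧ r < 1 ∧ z ∈ Metric.ball (0 : ℂ) r := by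
    intro z hz
    have hz' : ‖z‖ < 1 := by simpa [disk] using hz
    obtain ⟨r, h1, h2⟩ := exists_between hz'
    exact ⟨r, (norm_nonneg z).trans_lt h1, h2, by simpa using h1⟩
  constructor
  · intro z hz
    obtain ⟨r, hr0, hr1, hzr⟩ := hr z hz
    obtain ⟨u, hu, hub⟩ := hbound r hr0 hr1
    have := Complex.differentiableOn_tsum_of_summable_norm (F := fun p z => d p * z ^ (p - k)) hu
      (fun p => ((differentiable_pow (p - k)).const_mul (d p)).differentiableOn)
      Metric.isOpen_ball hub
    exact (this.differentiableAt (Metric.isOpen_ball.mem_nhds hzr)).differentiableWithinAt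
  · intro z hz
    obtain ⟨r, hr0, hr1, hzr⟩ := hr z hz
    obtain ⟨u, hu, hub⟩ := hbound r hr0 hr1
    exact Summable.of_norm_bounded hu fun p => hub p z hzr

/-- The normalized disk polynomial as a polynomial function on the whole plane. -/
noncomputable def normPoly (α : ℝ) (p q : ℕ) (z : ℂ) : ℂ := (rawNorm α p q : ℂ) * rawPoly α p q z

theorem continuous_normPoly (α : ℝ) (p q : ℕ) : Continuous (normPoly α p q) :=
  continuous_const.mul (continuous_rawPoly α p q)

theorem hasHolomorphicCoeffs_normPoly (α : ℝ) (p q : ℕ) (U : Set ℂ) :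
    HasHolomorphicCoeffs (q + 1) (normPoly α p q) U :=
  (hasHolomorphicCoeffs_rawPoly α p q U).holomorphic_mul (differentiableOn_const _)

/-- For fixed `q` the expansion is summed by collecting the powers of `1 - z z̄`; each of them has a
holomorphic power series as its coefficient. -/
theorem exists_hasSum_normPoly_fixed {α : ℝ} (hα : -1 < α) (q : ℕ) {c : ℕ → ℂ} {B : ℝ}
    (hc : ∀ p, ‖c p‖ ≤ B) :
    ∃ g : ℂ → ℂ, HasHolomorphicCoeffs (q + 1) g disk ∧
      ∀ z ∈ disk, HasSum (fun p => c p * normPoly α p q z) (g z) := by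
  obtain ⟨C, M, hCM⟩ := exists_rawNorm_le hα q
  have hB : 0 ≤ B := (norm_nonneg _).trans (hc 0)
  have hd : ∀ k p : ℕ, ‖c p * rawNorm α p q * (p.descFactorial k : ℂ)‖ ≤
      (B * C) * ((p : ℝ) + 1) ^ (M + k) := by
    intro k p
    have h1 : ((p.descFactorial k : ℕ) : ℝ) ≤ ((p : ℝ) + 1) ^ k := by
      calc ((p.descFactorial k : ℕ) : ℝ) ≤ (p : ℝ) ^ k := by
            exact_mod_cast Nat.descFactorial_le_pow p k
        _ ≤ _ := by gcongr; linarith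
    have h2 := hCM p
    have h3 := rawNorm_nonneg α p q
    rw [norm_mul, norm_mul, Complex.norm_real, Complex.norm_natCast, Real.norm_eq_abs,
      abs_of_nonneg h3, pow_add]
    calc ‖c p‖ * rawNorm α p q * (p.descFactorial k : ℝ)
        ≤ B * (C * ((p : ℝ) + 1) ^ M) * ((p : ℝ) + 1) ^ k := by
          gcongr
          · exact mul_nonneg hB (h3.trans h2)
          · exact hc p
      _ = _ := by ring
  have hser := fun k => differentiableOn_tsum_of_polynomial_growth (hd k) k
  set h : ℕ → ℂ → ℂ := fun k z => ∑' p, c p * rawNorm α p q * (p.descFactorial k : ℂ) *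
    z ^ (p - k) with hh
  refine ⟨fun z => ∑ k ∈ Finset.range (q + 1),
    ((-1) ^ k * ((q.choose k / Real.Gamma (α + k + 1) : ℝ) : ℂ) * h k z) * conj z ^ (q - k) *
      (1 - z * conj z) ^ k, ?_, ?_⟩
  · refine HasHolomorphicCoeffs.sum _ fun k hk => ?_
    exact hasHolomorphicCoeffs_rawPoly_term (Nat.lt_succ_iff.1 (Finset.mem_range.1 hk))
      ((hser k).1.const_mul _)
  · intro z hz
    have h1 : ∀ p, c p * normPoly α p q z = ∑ k ∈ Finset.range (q + 1),
        ((-1) ^ k * ((q.choose k / Real.Gamma (α + k + 1) : ℝ) : ℂ) *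
          (c p * rawNorm α p q * (p.descFactorial k : ℂ) * z ^ (p - k))) * conj z ^ (q - k) *
          (1 - z * conj z) ^ k := by
      intro p
      rw [normPoly, rawPoly, Finset.mul_sum, Finset.mul_sum]
      refine Finset.sum_congr rfl fun k _ => ?_
      push_cast
      ring
    simp only [h1]
    refine hasSum_sum fun k _ => ?_
    exact ((((hser k).2 z hz).hasSum.mul_left _).mul_right _).mul_right _

/-- Expansions in the disk polynomials with bounded coefficients converge pointwise on the disk,
with an `n`-analytic sum. -/
theorem exists_hasSum_normPoly {α : ℝ} (hα : -1 < α) {n : ℕ} {c : ℕ × Fin n → ℂ} {B : ℝ}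
    (hc : ∀ i, ‖c i‖ ≤ B) :
    ∃ g : ℂ → ℂ, HasHolomorphicCoeffs n g disk ∧
      ∀ z ∈ disk, HasSum (fun i : ℕ × Fin n => c i * normPoly α i.1 i.2 z) (g z) := by
  choose g hg hgs using fun q : Fin n =>
    exists_hasSum_normPoly_fixed hα q (c := fun p => c (p, q)) fun p => hc (p, q)
  refine ⟨fun z => ∑ q, g q z, HasHolomorphicCoeffs.sum _ fun q _ => (hg q).mono q.2,
    fun z hz => ?_⟩
  have h1 : (fun i : ℕ × Fin n => c i * normPoly α i.1 i.2 z) = fun i => ∑ q : Fin n,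
      if i.2 = q then c i * normPoly α i.1 i.2 z else 0 := by
    funext i
    simp
  rw [h1]
  refine hasSum_sum fun q _ => ?_
  have hinj : Function.Injective fun p : ℕ => (p, q) := fun a b hab => by simpa using hab
  rw [← hinj.hasSum_iff]
  · simpa [Function.comp_def] using hgs q z hz
  · rintro ⟨p, q'⟩ hi
    rw [if_neg]
    rintro rfl
    exact hi ⟨p, rfl⟩

/-! ### The orthonormal system and the Hilbert basis -/

theorem memLp_normPoly {α : ℝ} (hα : -1 < α) (p q : ℕ) :
    MemLp (normPoly α p q) 2 (diskMeasure α) := by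
  have := isFiniteMeasure_diskMeasure hα
  obtain ⟨C, hC⟩ := exists_norm_le_on_disk (continuous_normPoly α p q)
  exact MemLp.of_bound (continuous_normPoly α p q).aestronglyMeasurable C
    ((ae_mem_disk α).mono hC)

/-- The normalized disk polynomial as an element of `L²`. -/
noncomputable def normPolyLp {α : ℝ} (hα : -1 < α) (p q : ℕ) : Lp ℂ 2 (diskMeasure α) :=
  (memLp_normPoly hα p q).toLp

theorem coeFn_normPolyLp {α : ℝ} (hα : -1 < α) (p q : ℕ) :
    normPolyLp hα p q =ᵐ[diskMeasure α] normPoly α p q :=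
  (memLp_normPoly hα p q).coeFn_toLp

theorem inner_normPolyLp {α : ℝ} (hα : -1 < α) (F : Lp ℂ 2 (diskMeasure α)) {f : ℂ → ℂ}
    (hF : F =ᵐ[diskMeasure α] f) (p q : ℕ) :
    inner ℂ F (normPolyLp hα p q) =
      rawNorm α p q * ∫ z, conj (f z) * rawPoly α p q z ∂diskMeasure α := by
  rw [L2.inner_def, ← integral_const_mul]
  refine integral_congr_ae ?_
  filter_upwards [hF, coeFn_normPolyLp hα p q] with z h1 h2
  rw [h1, h2, normPoly, RCLike.inner_apply]
  ring

theorem rawNorm_pos {α : ℝ} (hα : -1 < α) (p q : ℕ) : 0 < rawNorm α p q := by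
  refine (rawNorm_nonneg α p q).lt_of_ne' fun h => ?_
  have := integral_conj_rawPoly_mul_self hα p q
  simp [h] at this

theorem orthonormal_normPolyLp {α : ℝ} (hα : -1 < α) (n : ℕ) :
    Orthonormal ℂ fun i : ℕ × Fin n => normPolyLp hα i.1 i.2 := by
  rw [orthonormal_iff_ite]
  have key : ∀ p q p' q' : ℕ, inner ℂ (normPolyLp hα p' q') (normPolyLp hα p q) =
      rawNorm α p q * (rawNorm α p' q' *
        ∫ z, conj (rawPoly α p' q' z) * rawPoly α p q z ∂diskMeasure α) := by
    intro p q p' q'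
    rw [inner_normPolyLp hα _ (coeFn_normPolyLp hα p' q'),
      ← integral_const_mul (rawNorm α p' q' : ℂ)]
    congr 2
    funext z
    simp only [normPoly, map_mul, Complex.conj_ofReal]
    ring
  rintro ⟨p', q'⟩ ⟨p, q⟩
  rw [key]
  split_ifs with h
  · obtain ⟨rfl, rfl⟩ := Prod.mk.inj h
    rw [← integral_conj_rawPoly_mul_self hα p' q']
    push_cast
    ring
  · rw [integral_conj_rawPoly_mul_rawPoly_of_ne hα, mul_zero, mul_zero]
    intro h'
    obtain ⟨h1, h2⟩ := Prod.mk.inj h'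
    exact h (Prod.ext h1 (Fin.ext h2))

theorem eq_zero_of_inner_normPolyLp {α : ℝ} (hα : -1 < α) {n : ℕ}
    {F : Lp ℂ 2 (diskMeasure α)} (hF : F ∈ polyBergman n α)
    (h : ∀ i : ℕ × Fin n, inner ℂ F (normPolyLp hα i.1 i.2) = 0) : F = 0 := by
  have := isFiniteMeasure_diskMeasure hα
  obtain ⟨f, hf, hFf⟩ := hF
  have hfi : Integrable f (diskMeasure α) :=
    ((Lp.memLp F).integrable one_le_two).congr hFf
  have h0 := eqOn_zero_of_integral_eq_zero hα ((isPolyanalyticOn_iff isOpen_disk).1 hf) hfi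
    fun p q hq => by
      have h1 := h (p, ⟨q, hq⟩)
      rw [inner_normPolyLp hα F hFf] at h1
      exact (mul_eq_zero.1 h1).resolve_left (by exact_mod_cast (rawNorm_pos hα p q).ne')
  rw [Lp.eq_zero_iff_ae_eq_zero]
  filter_upwards [hFf, ae_mem_disk α] with z h1 h2
  rw [h1, h0 h2]

theorem normPolyLp_mem {α : ℝ} (hα : -1 < α) {n : ℕ} (p : ℕ) {q : ℕ} (hq : q < n) :
    normPolyLp hα p q ∈ polyBergman n α :=
  ⟨normPoly α p q, (isPolyanalyticOn_iff isOpen_disk).2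
    ((hasHolomorphicCoeffs_normPoly α p q disk).mono hq), coeFn_normPolyLp hα p q⟩

/-- An `L²`-convergent expansion in the disk polynomials has an `n`-analytic sum. -/
theorem mem_polyBergman_of_hasSum {α : ℝ} (hα : -1 < α) {n : ℕ} {c : ℕ × Fin n → ℂ} {B : ℝ}
    (hc : ∀ i, ‖c i‖ ≤ B) {F : Lp ℂ 2 (diskMeasure α)}
    (hF : HasSum (fun i : ℕ × Fin n => c i • normPolyLp hα i.1 i.2) F) :
    F ∈ polyBergman n α := by
  obtain ⟨g, hg, hgs⟩ := exists_hasSum_normPoly hα hc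
  refine ⟨g, (isPolyanalyticOn_iff isOpen_disk).2 hg, ?_⟩
  obtain ⟨ns, hns, hae⟩ := (tendstoInMeasure_of_tendsto_Lp hF).exists_seq_tendsto_ae'
  have hterm : ∀ᵐ z ∂diskMeasure α, ∀ i : ℕ × Fin n,
      (c i • normPolyLp hα i.1 i.2 : Lp ℂ 2 (diskMeasure α)) z = c i * normPoly α i.1 i.2 z := by
    rw [ae_all_iff]
    intro i
    filter_upwards [Lp.coeFn_smul (c i) (normPolyLp hα i.1 i.2),
      coeFn_normPolyLp hα i.1 i.2] with z h1 h2
    rw [h1, Pi.smul_apply, h2, smul_eq_mul]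
  have hsum : ∀ᵐ z ∂diskMeasure α, ∀ j : ℕ,
      (∑ i ∈ ns j, c i • normPolyLp hα i.1 i.2 : Lp ℂ 2 (diskMeasure α)) z =
        ∑ i ∈ ns j, (c i • normPolyLp hα i.1 i.2 : Lp ℂ 2 (diskMeasure α)) z := by
    rw [ae_all_iff]
    intro j
    filter_upwards [Lp.coeFn_finsetSum (ns j) fun i => c i • normPolyLp hα i.1 i.2] with z h1
    rw [h1, Finset.sum_apply]
  filter_upwards [hae, hterm, hsum, ae_mem_disk α] with z h1 h2 h3 h4
  simp only [h3, h2] at h1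
  exact tendsto_nhds_unique h1 ((hgs z h4).comp hns)

/-- The Bergman space coincides with the range `K` of the isometry from `ℓ²` defined by the disk
polynomials, which is complete. -/
theorem completeSpace_polyBergman {α : ℝ} (hα : -1 < α) (n : ℕ) :
    CompleteSpace (polyBergman n α) := by
  have hon := orthonormal_normPolyLp hα n
  set V := hon.orthogonalFamily.linearIsometry with hV
  set K := LinearMap.range V.toLinearMap
  have hKc : IsComplete (K : Set (Lp ℂ 2 (diskMeasure α))) := by
    have h := V.isometry.isUniformInducing.isComplete_range
    have hr : (K : Set (Lp ℂ 2 (diskMeasure α))) = Set.range V := LinearMap.coe_range _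
    rw [hr]
    exact h
  have hKi : CompleteSpace K := hKc.completeSpace_coe
  have hle : K ≤ polyBergman n α := by
    rintro _ ⟨c, rfl⟩
    refine mem_polyBergman_of_hasSum hα (c := c) (B := ‖c‖)
      (fun i => lp.norm_apply_le_norm two_ne_zero c i) ?_
    simpa using hon.orthogonalFamily.hasSum_linearIsometry c
  have hmem : ∀ i : ℕ × Fin n, normPolyLp hα i.1 i.2 ∈ K := by
    classical
    intro i
    refine ⟨lp.single 2 i (1 : ℂ), ?_⟩
    have := hon.orthogonalFamily.linearIsometry_apply_single (i := i) (1 : ℂ)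
    exact this.trans (one_smul ℂ _)
  have heq : polyBergman n α = K := by
    refine le_antisymm (fun F hF => ?_) hle
    have h0 : F - K.starProjection F = 0 := by
      refine eq_zero_of_inner_normPolyLp hα (n := n)
        (sub_mem hF (hle (K.starProjection_apply_mem F))) fun i => ?_
      exact Submodule.inner_left_of_mem_orthogonal (hmem i)
        (Submodule.sub_starProjection_mem_orthogonal F)
    rw [sub_eq_zero.1 h0]
    exact K.starProjection_apply_mem F
  rw [heq]
  exact hKi

end PolyBergman

/-- The disk polynomials `b_{p,q}^{(α)}` with `q < n` are `n`-analytic on the disk and form an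
orthonormal (Hilbert) basis of the weighted `n`-analytic Bergman space; the Rodrigues-type formula
defining them agrees on the disk with the one through shifted Jacobi polynomials. -/
theorem proposition5p1 (n : ℕ) (hn : 1 ≤ n) (α : ℝ) (hα : -1 < α) :
    (∀ p q : ℕ, ∀ z ∈ PolyBergman.disk,
      PolyBergman.diskPoly α p q z = PolyBergman.diskPolyJacobi α p q z) ∧
    (∀ p q : ℕ, q < n →
      PolyBergman.IsPolyanalyticOn n (PolyBergman.diskPoly α p q) PolyBergman.disk) ∧
    ∃ B : HilbertBasis (ℕ × Fin n) ℂ (PolyBergman.polyBergman n α),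
      ∀ (p : ℕ) (q : Fin n),
        ((B (p, q) : PolyBergman.polyBergman n α) :
            MeasureTheory.Lp ℂ 2 (PolyBergman.diskMeasure α))
          =ᵐ[PolyBergman.diskMeasure α] PolyBergman.diskPoly α p q := by
  open PolyBergman in
  refine ⟨fun p q z hz => ?_, fun p q hq => ?_, ?_⟩
  · rw [diskPoly_eq_rawPoly hα p q hz, diskPolyJacobi_eq_rawPoly hα]
  · rw [isPolyanalyticOn_iff isOpen_disk]
    exact ((hasHolomorphicCoeffs_normPoly α p q disk).mono hq).congr (diskPoly_eq_rawPoly hα p q)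
  · have hcomplete := completeSpace_polyBergman hα n
    set v : ℕ × Fin n → polyBergman n α := fun i =>
      ⟨normPolyLp hα i.1 i.2, normPolyLp_mem hα i.1 i.2.2⟩ with hv
    have hon : Orthonormal ℂ v := (orthonormal_normPolyLp hα n).codRestrict _ _
    have hbot : (Submodule.span ℂ (Set.range v))ᗮ = ⊥ := by
      rw [Submodule.eq_bot_iff]
      intro F hF
      refine Subtype.ext (eq_zero_of_inner_normPolyLp hα F.2 fun i => ?_)
      have := Submodule.inner_left_of_mem_orthogonal
        (Submodule.subset_span (Set.mem_range_self i)) hF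
      exact this
    refine ⟨HilbertBasis.mkOfOrthogonalEqBot hon hbot, fun p q => ?_⟩
    rw [HilbertBasis.coe_mkOfOrthogonalEqBot]
    filter_upwards [coeFn_normPolyLp hα p q, ae_mem_disk α] with z h1 h2
    rw [diskPoly_eq_rawPoly hα p q h2]
    exact h1
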